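/- **Conventions.** Let $\aleph_0\le\kappa\le\lambda$ be cardinals and $I\subseteq\mathcal P(\lambda)$. Call $I$ *$\kappa$-robust* if every $\alpha<\lambda$ belongs to some $s\in I$, and $|s\cap\kappa|<\kappa$ for every $s\in I$. For $F:[\lambda]^2\to\mathcal P_\kappa\lambda$ let $$C(F)=\{s\in I : s\text{ is infinite and }F(\{x,y\})\subseteq s\text{ for all distinct }x,y\in s\};$$ a set $C\subseteq I$ *contains a strong $\kappa$-club* if $C(F)\subseteq C$ for some such $F$. An ultrafilter on $I$ is identified with an ultrafilter $U$ on $\mathcal P(\lambda)$ with $I\in U$. $U$ is *fine* if $\{s:\alpha\in s\}\in U$ for all $\alpha<\lambda$; *normal* if for every $F:\mathcal P(\lambda)\to\lambda$ with $\{s:F(s)\in s\}\in U$ there is $\alpha<\lambda$ with $\{s:F(s)=\alpha\}\in U$; *$\mu$-complete* if it is closed under intersections of fewer than $\mu$ members; *maximally $\kappa$-complete* if it is $\kappa$-complete and not $\kappa^+$-complete. For infinite cardinals $\nu\le\mu$, $\mathbb L_{\mu,\nu}(\tau)$ is the infinitary logic over a vocabulary $\tau$ with function and relation symbols of arity $<\nu$,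 with negation, conjunctions of fewer than $\mu$ formulas having together fewer than $\nu$ free variables, and quantification over fewer than $\nu$ variables at once. Structures are nonempty, and a structure omits a type $p(x)$ if no element of it satisfies all formulas of $p$. For $\kappa$-robust $I$, the logic $\mathbb L_{\mu,\nu}$ is *$I$-$\kappa$-compact for type omission* if the following holds for every such vocabulary $\tau$, every $\mathbb L_{\mu,\nu}(\tau)$-theory $T=\bigcup_{s\in I}T_s$ (where $s\subseteq t$ implies $T_s\subseteq T_t$, and there are sets $T^\alpha$, $\alpha<\lambda$, with $T_s=\bigcup_{\alpha\in s}T^\alpha$ for all $s\in I$), and every family, indexed by an arbitrary set $A$, of $\mathbb L_{\mu,\nu}(\tau)$-types $p^a(x)=\{\phi^a_\alpha(x):\alpha<\lambda\}$, with $p^a_s=\{\phi^a_\alpha:\alpha\in s\}$: if the set of all $s\in I$ such that $T_s$ has a model omitting every $p^a_s$ ($a\in A$) contains a strong $\kappa$-club, then $T$ has a model omitting every $p^a$ ($a\in A$). **Theorem.** Let $\aleph_0\le\kappa\le\lambda$ be cardinals and let $I\subseteq\mathcal P(\lambda)$ be $\kappa$-robust. The following are equivalent: 1. $\mathbb L_{\kappa,\omega}$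 is $I$-$\kappa$-compact for type omission. 2. $\mathbb L_{\kappa,\kappa}$ is $I$-$\kappa$-compact for type omission. 3. There is a fine, normal, maximally $\kappa$-complete ultrafilter on $\mathcal P(\lambda)$ that contains $I$. 4. There are a transitive class $\mathcal M$ and an elementary embedding $j:V\to\mathcal M$ (for the language $\{\in\}$) with $\operatorname{crit} j=\kappa$ and $j''\lambda\in\mathcal M\cap j(I)$. Moreover, if $\mathbb L_{\mu,\omega}$ is $I$-$\kappa$-compact for type omission for some infinite cardinal $\mu$, then the least such $\mu$ is the least infinite cardinal $\mu$ for which there is a fine, normal, $\mu$-complete ultrafilter on $I$. Furthermore, for every infinite cardinal $\mu$, $\mathbb L_{\mu,\omega}$ is $I$-$\kappa$-compact for type omission if and only if there is a fine, normal, $\mu$-complete ultrafilter on $I$ that contains every $C\subseteq I$ that contains a strong $\kappa$-club. -/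

import Mathlib

open Cardinal
open scoped FirstOrder

universe u

/-! ### Cardinals as sets of ordinals -/

/-- The set of ordinals below the initial ordinal of the cardinal `c`, i.e. `c` itself viewed as a
von Neumann cardinal (as a well-ordered type in the same universe). -/
abbrev CardIdx (c : Cardinal.{u}) : Type u := c.ord.ToType

/-! ### Families `I ⊆ P(lam)` -/

/-- `I ⊆ P(lam)` is `κ`-robust: every `α < lam` belongs to some `s ∈ I`, and
`|s ∩ κ| < κ` for every `s ∈ I`. -/
def IsRobust (κ : Cardinal.{u}) {lam : Cardinal.{u}} (I : Set (Set (CardIdx lam))) : Prop :=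
  (∀ α : CardIdx lam, ∃ s ∈ I, α ∈ s) ∧
    ∀ s ∈ I, #{x : CardIdx lam // x ∈ s ∧ (x : Ordinal.{u}) < κ.ord} < κ

/-- `C(F)`: the infinite `s ∈ I` with `F {x, y} ⊆ s` for all distinct `x, y ∈ s`
(`F` is a function on unordered pairs; its values on the diagonal are never used). -/
def closureSet {lam : Cardinal.{u}} (I : Set (Set (CardIdx lam)))
    (F : Sym2 (CardIdx lam) → Set (CardIdx lam)) : Set (Set (CardIdx lam)) :=
  {s | s ∈ I ∧ s.Infinite ∧ ∀ x ∈ s, ∀ y ∈ s, x ≠ y → F s(x, y) ⊆ s}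

/-- `C ⊆ I` contains a strong `κ`-club: `C(F) ⊆ C` for some `F : [lam]² → P_κ(lam)`. -/
def ContainsStrongClub (κ : Cardinal.{u}) {lam : Cardinal.{u}} (I C : Set (Set (CardIdx lam))) :
    Prop :=
  C ⊆ I ∧ ∃ F : Sym2 (CardIdx lam) → Set (CardIdx lam),
    (∀ p, #(F p) < κ) ∧ closureSet I F ⊆ C

/-! ### Ultrafilters on `P(lam)`

An ultrafilter on `I` is identified with an ultrafilter on `P(lam)` that contains `I`.
`μ`-completeness is Mathlib's `CardinalInterFilter`. -/

/-- `U` is fine: `{s | α ∈ s} ∈ U` for every `α < lam`. -/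
def IsFine {lam : Cardinal.{u}} (U : Ultrafilter (Set (CardIdx lam))) : Prop :=
  ∀ α : CardIdx lam, {s : Set (CardIdx lam) | α ∈ s} ∈ U

/-- `U` is normal: every function that is regressive on a set in `U` is constant on a set
in `U`. -/
def IsNormalUltrafilter {lam : Cardinal.{u}} (U : Ultrafilter (Set (CardIdx lam))) : Prop :=
  ∀ F : Set (CardIdx lam) → CardIdx lam, {s | F s ∈ s} ∈ U →
    ∃ α : CardIdx lam, {s | F s = α} ∈ U

/-- `U` is `μ`-complete: intersections of fewer than `μ` members of `U` belong to `U`. -/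
def IsCompleteUltrafilter (μ : Cardinal.{u}) {lam : Cardinal.{u}}
    (U : Ultrafilter (Set (CardIdx lam))) : Prop :=
  CardinalInterFilter (U : Filter (Set (CardIdx lam))) μ

/-- `U` is maximally `κ`-complete: `κ`-complete and not `κ⁺`-complete. -/
def IsMaximallyComplete (κ : Cardinal.{u}) {lam : Cardinal.{u}}
    (U : Ultrafilter (Set (CardIdx lam))) : Prop :=
  IsCompleteUltrafilter κ U ∧ ¬ IsCompleteUltrafilter (Order.succ κ) U

/-! ### Infinitary logics `L_{μ,ν}` -/

/-- A vocabulary with function and relation symbols of arbitrary arity; the arity is given as an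
index set for the arguments. -/
structure Vocab : Type (u + 1) where
  Fn : Type u
  fnArity : Fn → Type u
  Rl : Type u
  rlArity : Rl → Type u

/-- All symbols of `τ` have arity `< ν`. -/
def Vocab.ArityLT (τ : Vocab.{u}) (ν : Cardinal.{u}) : Prop :=
  (∀ f, #(τ.fnArity f) < ν) ∧ ∀ R, #(τ.rlArity R) < ν

/-- `τ`-structures on the set `M`. -/
structure VocabStr (τ : Vocab.{u}) (M : Type u) where
  fn : (f : τ.Fn) → (τ.fnArity f → M) → M
  rl : (R : τ.Rl) → (τ.rlArity R → M) → Prop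

/-- Terms with variables from `X`. -/
inductive InfTerm (τ : Vocab.{u}) (X : Type u) : Type u
  | var (x : X) : InfTerm τ X
  | app (f : τ.Fn) (ts : τ.fnArity f → InfTerm τ X) : InfTerm τ X

/-- Infinitary formulas with variables from `μ`, conjunctions of sequences of length `< μ` and
universal quantification over sets of variables. The other connectives and the existential
quantifier are abbreviations. The restrictions on the number of variables that are part of
`L_{μ,ν}` are imposed in `InfFormula.IsIn`. -/
inductive InfFormula (τ : Vocab.{u}) (μ : Cardinal.{u}) : Type u
  | eq (t₁ t₂ : InfTerm τ (CardIdx μ)) : InfFormula τ μ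
  | rel (R : τ.Rl) (ts : τ.rlArity R → InfTerm τ (CardIdx μ)) : InfFormula τ μ
  | neg (φ : InfFormula τ μ) : InfFormula τ μ
  | conj (a : CardIdx μ) (φ : Set.Iio a → InfFormula τ μ) : InfFormula τ μ
  | all (B : Set (CardIdx μ)) (φ : InfFormula τ μ) : InfFormula τ μ

/-- The variables of a term. -/
def InfTerm.vars {τ : Vocab.{u}} {X : Type u} : InfTerm τ X → Set X
  | .var x => {x}
  | .app _ ts => ⋃ i, (ts i).vars

/-- The free variables of a formula. -/
def InfFormula.free {τ : Vocab.{u}} {μ : Cardinal.{u}} : InfFormula τ μ → Set (CardIdx μ)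
  | .eq t₁ t₂ => t₁.vars ∪ t₂.vars
  | .rel _ ts => ⋃ i, (ts i).vars
  | .neg φ => φ.free
  | .conj _ φ => ⋃ i, (φ i).free
  | .all B φ => φ.free \ B

/-- The formula belongs to `L_{μ,ν}`: every conjunction has (all its members together)
fewer than `ν` free variables, and every quantifier binds fewer than `ν` variables. -/
def InfFormula.IsIn {τ : Vocab.{u}} {μ : Cardinal.{u}} (ν : Cardinal.{u}) :
    InfFormula τ μ → Prop
  | .eq _ _ => True
  | .rel _ _ => True
  | .neg φ => φ.IsIn ν
  | .conj _ φ => (∀ i, (φ i).IsIn ν) ∧ #(⋃ i, (φ i).free : Set (CardIdx μ)) < ν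
  | .all B φ => #B < ν ∧ φ.IsIn ν

/-- The value of a term under an assignment. -/
def InfTerm.val {τ : Vocab.{u}} {X M : Type u} (S : VocabStr τ M) (v : X → M) : InfTerm τ X → M
  | .var x => v x
  | .app f ts => S.fn f fun i => (ts i).val S v

/-- Satisfaction of a formula under an assignment. -/
def InfFormula.Sat {τ : Vocab.{u}} {μ : Cardinal.{u}} {M : Type u} (S : VocabStr τ M) :
    InfFormula τ μ → (CardIdx μ → M) → Prop
  | .eq t₁ t₂, v => t₁.val S v = t₂.val S v
  | .rel R ts, v => S.rl R fun i => (ts i).val S v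
  | .neg φ, v => ¬ φ.Sat S v
  | .conj _ φ, v => ∀ i, (φ i).Sat S v
  | .all B φ, v => ∀ w : CardIdx μ → M, (∀ x, x ∉ B → w x = v x) → φ.Sat S w

/-- `T` has a (nonempty) model that omits each of the types `p a`. The formulas of `p a` have at
most one fixed free variable `x`, so an element `m` satisfies such a formula iff the assignment with
constant value `m` does. -/
def HasModelOmitting {τ : Vocab.{u}} {μ : Cardinal.{u}} (T : Set (InfFormula τ μ)) {A : Type u}
    (p : A → Set (InfFormula τ μ)) : Prop :=
  ∃ (M : Type u) (_ : Nonempty M) (S : VocabStr τ M),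
    (∀ ψ ∈ T, ∀ v, ψ.Sat S v) ∧
    ∀ a, ¬ ∃ m : M, ∀ φ ∈ p a, φ.Sat S fun _ => m

/-! ### Compactness for type omission -/

/-- `X` is the increasing union of the family `Xs s`, `s ∈ I`. -/
def IsIndexedFiltration {lam : Cardinal.{u}} (I : Set (Set (CardIdx lam))) {E : Type u} (X : Set E)
    (Xs : Set (CardIdx lam) → Set E) : Prop :=
  (∀ s ∈ I, ∀ t ∈ I, s ⊆ t → Xs s ⊆ Xs t) ∧ X = ⋃ s ∈ I, Xs s

/-- The filtration respects the index: `Xs s = ⋃_{α ∈ s} Y α` for some family `Y`. -/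
def RespectsIndex {lam : Cardinal.{u}} (I : Set (Set (CardIdx lam))) {E : Type u}
    (Xs : Set (CardIdx lam) → Set E) : Prop :=
  ∃ Y : CardIdx lam → Set E, ∀ s ∈ I, Xs s = ⋃ α ∈ s, Y α

/-- The logic `L_{μ,ν}` is `I`-`κ`-compact for type omission. The type `p^a` is enumerated as
`{p a α : α < lam}`, and `p^a_s = {p a α : α ∈ s}`. -/
def IsCompactForTypeOmission (μ ν κ : Cardinal.{u}) {lam : Cardinal.{u}}
    (I : Set (Set (CardIdx lam))) : Prop :=
  ∀ (τ : Vocab.{u}) (_ : τ.ArityLT ν)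
    (T : Set (InfFormula τ μ)) (Ts : Set (CardIdx lam) → Set (InfFormula τ μ))
    (A : Type u) (x : CardIdx μ) (p : A → CardIdx lam → InfFormula τ μ),
    (∀ ψ ∈ T, ψ.IsIn ν ∧ ψ.free = ∅) →
    (∀ a α, (p a α).IsIn ν ∧ (p a α).free ⊆ {x}) →
    IsIndexedFiltration I T Ts → RespectsIndex I Ts →
    ContainsStrongClub κ I {s | s ∈ I ∧ HasModelOmitting (Ts s) fun a => p a '' s} →
    HasModelOmitting T fun a => Set.range (p a)

/-! ### Elementary embeddings of the universe of sets -/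

/-- The only nonlogical symbol of set theory: a binary relation symbol. -/
inductive MembershipRel : ℕ → Type
  | mem : MembershipRel 2

/-- The language of set theory. -/
def setLang : FirstOrder.Language.{0, 0} := ⟨fun _ => Empty, MembershipRel⟩

/-- A class `M` of sets, as a structure with the true membership relation. -/
instance classStr (M : Set ZFSet.{u}) : setLang.Structure M where
  funMap f _ := Empty.elim f
  RelMap r xs := match r, xs with
    | MembershipRel.mem, xs => (xs 0 : ZFSet.{u}) ∈ (xs 1 : ZFSet.{u})

/-- The class `M` is transitive. -/
def IsTransClass (M : Set ZFSet.{u}) : Prop := ∀ x ∈ M, ∀ y ∈ x, y ∈ M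

/-- `s ⊆ lam` as an element of the universe of sets (a set of von Neumann ordinals). -/
noncomputable def subsetCode {lam : Cardinal.{u}} (s : Set (CardIdx lam)) : ZFSet.{u} :=
  ZFSet.range fun x : s => ((x : CardIdx lam) : Ordinal.{u}).toZFSet

/-- `I ⊆ P(lam)` as an element of the universe of sets. -/
noncomputable def familyCode {lam : Cardinal.{u}} (I : Set (Set (CardIdx lam))) : ZFSet.{u} :=
  ZFSet.range fun s : I => subsetCode (s : Set (CardIdx lam))

/-- The elementary embedding `j : V → M`, as an operation on sets. -/
def embVal {M : Set ZFSet.{u}} (j : (Set.univ : Set ZFSet.{u}) ↪ₑ[setLang] M) (x : ZFSet.{u}) :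
    ZFSet.{u} := j ⟨x, trivial⟩

/-- `κ` is the critical point of `j`: the least ordinal moved by `j`. -/
def IsCrit {M : Set ZFSet.{u}} (j : (Set.univ : Set ZFSet.{u}) ↪ₑ[setLang] M)
    (κ : Cardinal.{u}) : Prop :=
  IsLeast {o : Ordinal.{u} | embVal j o.toZFSet ≠ o.toZFSet} κ.ord

/-- The pointwise image `j"lam`. -/
noncomputable def ptImage {M : Set ZFSet.{u}} (j : (Set.univ : Set ZFSet.{u}) ↪ₑ[setLang] M)
    (lam : Cardinal.{u}) : ZFSet.{u} :=
  ZFSet.range fun x : CardIdx lam => embVal j (x : Ordinal.{u}).toZFSet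

/-! Everything passes through fine normal ultrafilters `U` with `I ∈ U`.

From `U` to compactness (`isCompactForTypeOmission_of_ultrafilter`): take the ultraproduct of models
of `T_s` omitting the `p^a_s`. Łoś's theorem and fineness give a model of `T`. If `[m]` realized
`p^a`, then for almost every `s` some index `F s ∈ s` has its formula fail at `m s`. Normality makes
`F` constant, say `α`, and Łoś's theorem for the `α`-th formula is contradicted.

From compactness to `U` (`exists_ultrafilter_of_isCompactForTypeOmission`): give every `X ⊆ P(lam)`
a propositional constant, true at `s` iff `s ∈ X`. A truth assignment respecting the
`L_{μ,ω}`-sentences valid on `C` is a `μ`-complete ultrafilter containing `C`. Normality is the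
omission, for each `F`, of the type "`F` is regressive, but its value is not `α`" (`α < lam`). At
`s` this is omitted already by the indices in `s`: take `α = F s`.

Strong clubs link the degrees of completeness. One of them forces `s ∩ κ` to be an initial segment
of `κ`, which together with normality gives `κ`-completeness (`isComplete_of_initialSets_mem`).
Conversely, `κ`-completeness puts every strong club in `U` (`containsStrongClub_mem`). Robustness
excludes `κ⁺`-completeness.

For embeddings, `U` yields the collapsed ultrapower of the universe, where `j"lam` is the class of
the identity; conversely `X ∈ U` iff `j"lam ∈ j(X)`. -/

/-! ### Fine normal ultrafilters: completeness and strong clubs. -/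

section UltrafilterLemmas

variable {κ lam : Cardinal.{u}}

lemma cardIdx_coe_lt {x y : CardIdx lam} : (x : Ordinal.{u}) < (y : Ordinal.{u}) ↔ x < y :=
  (Ordinal.ToType.mk (o := lam.ord)).symm.lt_iff_lt

lemma cardIdx_coe_inj {x y : CardIdx lam} : (x : Ordinal.{u}) = (y : Ordinal.{u}) ↔ x = y := by
  rw [← Subtype.ext_iff, (Ordinal.ToType.mk (o := lam.ord)).symm.injective.eq_iff]

lemma cardIdx_coe_lt_ord (x : CardIdx lam) : (x : Ordinal.{u}) < lam.ord :=
  (Ordinal.ToType.toOrd x).2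

lemma exists_cardIdx_coe_eq {o : Ordinal.{u}} (h : o < lam.ord) :
    ∃ x : CardIdx lam, (x : Ordinal.{u}) = o :=
  ⟨Ordinal.ToType.mk ⟨o, h⟩, by simp⟩

lemma mk_cardIdx_lt {o : Ordinal.{u}} (ho : o ≤ lam.ord) :
    #{x : CardIdx lam // (x : Ordinal.{u}) < o} = o.card := by
  rw [← mk_toType]
  refine mk_congr ⟨fun x => Ordinal.ToType.mk ⟨x.1, x.2⟩,
    fun y => ⟨Ordinal.ToType.mk
      ⟨y.toOrd, Set.mem_Iio.2 ((Set.mem_Iio.1 y.toOrd.2).trans_le ho)⟩, ?_⟩,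
    fun x => ?_, fun y => ?_⟩
  · simpa using Set.mem_Iio.1 y.toOrd.2
  · ext; simp
  · simp

lemma mk_Iio_cardIdx (x : CardIdx lam) : #(Set.Iio x) = (x : Ordinal.{u}).card := by
  rw [← mk_cardIdx_lt (cardIdx_coe_lt_ord x).le]
  exact mk_congr (Equiv.subtypeEquivRight fun y => cardIdx_coe_lt.symm)

lemma mk_Iic_cardIdx_lt (hκ : ℵ₀ ≤ κ) {x : CardIdx lam} (h : (x : Ordinal.{u}) < κ.ord) :
    #(Set.Iic x) < κ := by
  have h1 : #(Set.Iio x) < κ := by rw [mk_Iio_cardIdx]; exact lt_ord.1 h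
  have h2 : Set.Iic x = insert x (Set.Iio x) := by simp
  rw [h2]
  exact (mk_insert_le).trans_lt (add_lt_of_lt hκ h1 (one_lt_aleph0.trans_le hκ))

lemma mk_below (h : κ ≤ lam) : #{x : CardIdx lam // (x : Ordinal.{u}) < κ.ord} = κ := by
  rw [mk_cardIdx_lt (ord_le_ord.2 h), card_ord]

/-- The sets whose intersection with `κ` is an initial segment of `κ`. -/
def initialSets (κ lam : Cardinal.{u}) : Set (Set (CardIdx lam)) :=
  {s | ∀ x ∈ s, (x : Ordinal.{u}) < κ.ord → ∀ y < x, y ∈ s}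

/-- The function closing a set under predecessors of its members below `κ`. -/
def initialClosure (κ lam : Cardinal.{u}) (p : Sym2 (CardIdx lam)) : Set (CardIdx lam) :=
  {z | ∃ x ∈ p, (x : Ordinal.{u}) < κ.ord ∧ z ≤ x}

lemma mk_initialClosure_lt (hκ : ℵ₀ ≤ κ) (p : Sym2 (CardIdx lam)) :
    #(initialClosure κ lam p) < κ := by
  have key : ∀ x : CardIdx lam, #{z : CardIdx lam | (x : Ordinal.{u}) < κ.ord ∧ z ≤ x} < κ := by
    intro x
    by_cases h : (x : Ordinal.{u}) < κ.ord
    · exact (mk_le_mk_of_subset fun z hz => hz.2).trans_lt (mk_Iic_cardIdx_lt hκ h)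
    · simp only [h, false_and]
      simpa using aleph0_pos.trans_le hκ
  induction p using Sym2.ind with
  | _ x y =>
    have hsub : initialClosure κ lam s(x, y) ⊆
        {z : CardIdx lam | (x : Ordinal.{u}) < κ.ord ∧ z ≤ x} ∪
          {z | (y : Ordinal.{u}) < κ.ord ∧ z ≤ y} := by
      rintro z ⟨w, hw, h⟩
      rcases Sym2.mem_iff.1 hw with rfl | rfl
      · exact Or.inl h
      · exact Or.inr h
    exact ((mk_le_mk_of_subset hsub).trans (mk_union_le _ _)).trans_lt
      (add_lt_of_lt hκ (key x) (key y))

lemma closureSet_initialClosure_subset (I : Set (Set (CardIdx lam))) :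
    closureSet I (initialClosure κ lam) ⊆ initialSets κ lam := by
  rintro s ⟨-, hinf, hs⟩ x hx hxκ y hy
  -- The closure condition concerns distinct pairs only, so `x` needs a partner; this is where `s`
  -- being infinite enters.
  obtain ⟨z, hz, hzx⟩ := hinf.exists_notMem_finite (Set.finite_singleton x)
  exact hs x hx z hz (fun h => hzx h.symm) ⟨x, Sym2.mem_mk_left _ _, hxκ, hy.le⟩

variable {U : Ultrafilter (Set (CardIdx lam))} {I : Set (Set (CardIdx lam))}

/-- If fewer than `κ` large sets had a small intersection, index them by the ordinals below some `γ
< κ` and let `F s` be the index of one that misses `s`. Once `γ ∈ s` and `s ∩ κ` is an initial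
segment, `F` is regressive; a constant value names one large set missed by almost every `s`. -/
lemma isComplete_of_initialSets_mem (hlam : κ ≤ lam) (hf : IsFine U)
    (hn : IsNormalUltrafilter U) (h : initialSets κ lam ∈ U) : IsCompleteUltrafilter κ U := by
  classical
  refine ⟨fun S hS hSU => ?_⟩
  by_contra hnot
  have hc : (⋂₀ S)ᶜ ∈ U := Ultrafilter.compl_mem_iff_notMem.2 hnot
  have hlt : (#S).ord < κ.ord := ord_lt_ord.2 hS
  obtain ⟨γ, hγ⟩ := exists_cardIdx_coe_eq (hlt.trans_le (ord_le_ord.2 hlam))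
  have hmk : #S = #(Set.Iio γ) := by rw [mk_Iio_cardIdx, hγ, card_ord]
  obtain ⟨e⟩ := Cardinal.eq.1 hmk
  let F : Set (CardIdx lam) → CardIdx lam := fun s =>
    if h : ∃ X : S, s ∉ X.1 then e h.choose else γ
  have hF : ∀ s ∈ (⋂₀ S)ᶜ, ∃ X : S, s ∉ X.1 ∧ F s = e X := by
    intro s hs
    have h : ∃ X : S, s ∉ X.1 := by simpa using hs
    exact ⟨h.choose, h.choose_spec, by simp only [F, dif_pos h]⟩
  have hreg : {s | F s ∈ s} ∈ U := by
    filter_upwards [hc, hf γ, h] with s hs hγs hi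
    obtain ⟨X, -, hX⟩ := hF s hs
    exact hi γ hγs (hγ ▸ hlt) _ (hX ▸ (e X).2)
  obtain ⟨α, hα⟩ := hn F hreg
  obtain ⟨s, hsα, hs⟩ := U.neBot.nonempty_of_mem (Filter.inter_mem hα hc)
  obtain ⟨X, -, hX⟩ := hF s hs
  have hXU := hSU X.1 X.2
  obtain ⟨t, ⟨htα, ht⟩, htX⟩ :=
    U.neBot.nonempty_of_mem (Filter.inter_mem (Filter.inter_mem hα hc) hXU)
  obtain ⟨Y, hY, hYe⟩ := hF t ht
  have : (e Y : CardIdx lam) = e X := by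
    rw [← hYe, ← hX]; exact (show F t = α from htα).trans (show F s = α from hsα).symm
  rw [e.injective (Subtype.ext this)] at hY
  exact hY htX

lemma superset_mem_of_isComplete (hf : IsFine U) (hc : IsCompleteUltrafilter κ U)
    {z : Set (CardIdx lam)} (hz : #z < κ) : {s | z ⊆ s} ∈ U := by
  have : CardinalInterFilter (U : Filter (Set (CardIdx lam))) κ := hc
  exact (Filter.eventually_cardinal_ball hz).2 fun α _ => hf α

/-- With `κ⁺`-completeness, fineness would give `κ ⊆ s` for almost every `s`, against `|s ∩ κ| < κ`
on `I`. -/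
lemma not_isComplete_succ (hlam : κ ≤ lam) (hI : IsRobust κ I) (hf : IsFine U) (hIU : I ∈ U) :
    ¬ IsCompleteUltrafilter (Order.succ κ) U := by
  intro hc
  have h := superset_mem_of_isComplete hf hc
    (z := {x : CardIdx lam | (x : Ordinal.{u}) < κ.ord})
    ((mk_below hlam).trans_lt (Order.lt_succ κ))
  obtain ⟨s, hs, hsI⟩ := U.neBot.nonempty_of_mem (Filter.inter_mem h hIU)
  refine (hI.2 s hsI).not_ge ?_
  refine (mk_below hlam).symm.le.trans ?_
  exact mk_subtype_le_of_subset fun x hx => ⟨hs hx, hx⟩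

/-- If `κ = ω`, each `s ∩ ω` is finite and its maximum is a regressive function. It would be
constant, say `α`, although almost every `s` contains `α + 1`. -/
lemma aleph0_lt_of_isNormal (hκ : ℵ₀ ≤ κ) (hlam : κ ≤ lam) (hI : IsRobust κ I) (hf : IsFine U)
    (hn : IsNormalUltrafilter U) (hIU : I ∈ U) : ℵ₀ < κ := by
  refine hκ.lt_of_ne ?_
  rintro rfl
  have : Nonempty (CardIdx lam) := by
    obtain ⟨x, -⟩ := exists_cardIdx_coe_eq (lam := lam) (o := 0)
      ((ord_pos.2 aleph0_pos).trans_le (ord_le_ord.2 hlam))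
    exact ⟨x⟩
  have hmax : ∀ s : Set (CardIdx lam), ∃ x : CardIdx lam,
      (s ∈ I → (∃ y ∈ s, (y : Ordinal.{u}) < (ℵ₀ : Cardinal.{u}).ord) →
        x ∈ s ∧ (x : Ordinal.{u}) < (ℵ₀ : Cardinal.{u}).ord ∧
          ∀ y ∈ s, (y : Ordinal.{u}) < (ℵ₀ : Cardinal.{u}).ord → y ≤ x) := by
    intro s
    by_cases h : s ∈ I ∧ ∃ y ∈ s, (y : Ordinal.{u}) < (ℵ₀ : Cardinal.{u}).ord
    · have hfin : {x | x ∈ s ∧ (x : Ordinal.{u}) < (ℵ₀ : Cardinal.{u}).ord}.Finite :=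
        lt_aleph0_iff_set_finite.1 (hI.2 s h.1)
      obtain ⟨x, hx, hm⟩ := Set.exists_max_image _ id hfin h.2
      exact ⟨x, fun _ _ => ⟨hx.1, hx.2, fun y hy hyω => hm y ⟨hy, hyω⟩⟩⟩
    · exact ⟨Classical.arbitrary _, fun h1 h2 => (h ⟨h1, h2⟩).elim⟩
  choose F hF using hmax
  obtain ⟨z, hz⟩ := exists_cardIdx_coe_eq (lam := lam) (o := 0)
    ((ord_pos.2 aleph0_pos).trans_le (ord_le_ord.2 hlam))
  have hzω : (z : Ordinal.{u}) < (ℵ₀ : Cardinal.{u}).ord := by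
    rw [hz]; exact ord_pos.2 aleph0_pos
  obtain ⟨α, hα⟩ := hn F (by
    filter_upwards [hIU, hf z] with s hs hzs
    exact (hF s hs ⟨z, hzs, hzω⟩).1)
  have hαω : (α : Ordinal.{u}) < (ℵ₀ : Cardinal.{u}).ord := by
    obtain ⟨s, ⟨hsα, hs⟩, hzs⟩ :=
      U.neBot.nonempty_of_mem (Filter.inter_mem (Filter.inter_mem hα hIU) (hf z))
    rw [← show F s = α from hsα]
    exact (hF s hs ⟨z, hzs, hzω⟩).2.1
  have hsucc := (isSuccLimit_ord (le_refl (ℵ₀ : Cardinal.{u}))).succ_lt hαω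
  obtain ⟨β, hβ⟩ := exists_cardIdx_coe_eq (hsucc.trans_le (ord_le_ord.2 hlam))
  obtain ⟨s, ⟨hsα, hs⟩, hβs⟩ :=
    U.neBot.nonempty_of_mem (Filter.inter_mem (Filter.inter_mem hα hIU) (hf β))
  have hβω : (β : Ordinal.{u}) < (ℵ₀ : Cardinal.{u}).ord := by rwa [hβ]
  have hle := (hF s hs ⟨β, hβs, hβω⟩).2.2 β hβs hβω
  rw [show F s = α from hsα] at hle
  refine hle.not_gt (cardIdx_coe_lt.1 ?_)
  rw [hβ]
  exact Order.lt_succ _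

/-- If almost every `s` failed to be closed under `F`, normality applied twice would fix a single
bad pair `α, β`. But `F s(α, β)` has size `< κ`, so almost every `s` includes it. -/
lemma containsStrongClub_mem (hκ : ℵ₀ ≤ κ) (hlam : κ ≤ lam) (hI : IsRobust κ I) (hf : IsFine U)
    (hn : IsNormalUltrafilter U) (hc : IsCompleteUltrafilter κ U) (hIU : I ∈ U)
    {C : Set (Set (CardIdx lam))} (hC : ContainsStrongClub κ I C) : C ∈ U := by
  classical
  obtain ⟨-, F, hF, hFC⟩ := hC
  refine Filter.mem_of_superset ?_ hFC
  have hinf : {s : Set (CardIdx lam) | s.Infinite} ∈ U := by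
    have hω : (ℵ₀ : Cardinal.{u}) < #(CardIdx lam) := by
      rw [mk_ord_toType]; exact (aleph0_lt_of_isNormal hκ hlam hI hf hn hIU).trans_le hlam
    obtain ⟨z, hz⟩ := le_mk_iff_exists_set.1 hω.le
    filter_upwards [superset_mem_of_isComplete hf hc
      (hz.trans_lt (aleph0_lt_of_isNormal hκ hlam hI hf hn hIU))] with s hs
    refine Set.Infinite.mono hs ?_
    rw [← Set.infinite_coe_iff, infinite_iff, hz]
  have hcl : {s : Set (CardIdx lam) | ∀ x ∈ s, ∀ y ∈ s, F s(x, y) ⊆ s} ∈ U := by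
    by_contra hnot
    have hbad := Ultrafilter.compl_mem_iff_notMem.2 hnot
    obtain ⟨s₀, hs₀⟩ := U.neBot.nonempty_of_mem hbad
    have hex : ∀ s : Set (CardIdx lam), ∃ x, s ∈ {s : Set (CardIdx lam) | ∀ x ∈ s, ∀ y ∈ s,
        F s(x, y) ⊆ s}ᶜ → x ∈ s ∧ ∃ y ∈ s, ¬ F s(x, y) ⊆ s := by
      intro s
      by_cases h : ∃ x ∈ s, ∃ y ∈ s, ¬ F s(x, y) ⊆ s
      · obtain ⟨x, hx, h⟩ := h
        exact ⟨x, fun _ => ⟨hx, h⟩⟩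
      · push Not at h
        simp only [Set.mem_compl_iff, Set.mem_ofPred_eq, not_forall] at hs₀
        -- Only some element of `lam` is needed here as a default value.
        exact ⟨hs₀.choose, fun hs => (hs h).elim⟩
    choose f hf₁ using hex
    obtain ⟨α, hα⟩ := hn f (by filter_upwards [hbad] with s hs; exact (hf₁ s hs).1)
    have hex₂ : ∀ s : Set (CardIdx lam), ∃ y, s ∈ {s : Set (CardIdx lam) | ∀ x ∈ s, ∀ y ∈ s,
        F s(x, y) ⊆ s}ᶜ → y ∈ s ∧ ¬ F s(f s, y) ⊆ s := by
      intro s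
      by_cases h : ∃ y ∈ s, ¬ F s(f s, y) ⊆ s
      · obtain ⟨y, hy⟩ := h
        exact ⟨y, fun _ => hy⟩
      · exact ⟨α, fun hs => (h (hf₁ s hs).2).elim⟩
    choose g hg using hex₂
    obtain ⟨β, hβ⟩ := hn g (by filter_upwards [hbad] with s hs; exact (hg s hs).1)
    obtain ⟨s, ⟨⟨hsα, hsβ⟩, hs⟩, hss⟩ := U.neBot.nonempty_of_mem
      (Filter.inter_mem (Filter.inter_mem (Filter.inter_mem hα hβ) hbad)
        (superset_mem_of_isComplete hf hc (hF s(α, β))))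
    have := (hg s hs).2
    rw [show f s = α from hsα, show g s = β from hsβ] at this
    exact this hss
  filter_upwards [hIU, hinf, hcl] with s h1 h2 h3
  exact ⟨h1, h2, fun x hx y hy _ => h3 x hx y hy⟩

end UltrafilterLemmas

/-! ### Ultraproducts, Łoś's theorem, and compactness from an ultrafilter. -/

section Ultraproducts

variable {τ : Vocab.{u}} {μ ν : Cardinal.{u}} {J : Type u} (U : Ultrafilter J) {N : J → Type u}

/-- The ultraproduct of a family of structures for an infinitary vocabulary. -/
noncomputable def VocabStr.ultraproduct (S : ∀ j, VocabStr τ (N j)) :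
    VocabStr τ ((U : Filter J).Product N) where
  fn f xs := Quotient.mk _ fun j => (S j).fn f fun i => (xs i).out j
  rl R xs := ∀ᶠ j in U, (S j).rl R fun i => (xs i).out j

variable {U}

lemma eventually_out_eq (g : ∀ j, N j) :
    ∀ᶠ j in U, (Quotient.mk ((U : Filter J).productSetoid N) g).out j = g j :=
  Quotient.mk_out (s := (U : Filter J).productSetoid N) g

lemma InfTerm.val_ultraproduct (S : ∀ j, VocabStr τ (N j))
    [CardinalInterFilter (U : Filter J) ν] (hτ : τ.ArityLT ν) {X : Type u}
    (v : X → ∀ j, N j) (t : InfTerm τ X) :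
    t.val (VocabStr.ultraproduct U S) (fun x => Quotient.mk _ (v x)) =
      Quotient.mk _ fun j => t.val (S j) fun x => v x j := by
  induction t with
  | var x => rfl
  | app f ts ih =>
    refine Quotient.sound ?_
    have h : ∀ᶠ j in U, ∀ i, (Quotient.mk ((U : Filter J).productSetoid N)
        fun j => (ts i).val (S j) fun x => v x j).out j = (ts i).val (S j) fun x => v x j :=
      (Filter.eventually_cardinal_forall (hτ.1 f)).2 fun i => eventually_out_eq _
    simp only [ih]
    filter_upwards [h] with j hj
    simp only [InfTerm.val, hj]

/-- **Łoś's theorem** for infinitary logic and sufficiently complete ultrafilters. -/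
lemma InfFormula.sat_ultraproduct [∀ j, Nonempty (N j)] (S : ∀ j, VocabStr τ (N j))
    [CardinalInterFilter (U : Filter J) ν] [CardinalInterFilter (U : Filter J) μ]
    (hτ : τ.ArityLT ν) (φ : InfFormula τ μ) (v : CardIdx μ → ∀ j, N j) :
    φ.Sat (VocabStr.ultraproduct U S) (fun x => Quotient.mk _ (v x)) ↔
      ∀ᶠ j in U, φ.Sat (S j) fun x => v x j := by
  classical
  induction φ generalizing v with
  | eq t₁ t₂ =>
    simp only [InfFormula.Sat, InfTerm.val_ultraproduct (U := U) S hτ]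
    exact Quotient.eq
  | rel R ts =>
    simp only [InfFormula.Sat, InfTerm.val_ultraproduct (U := U) S hτ]
    have h : ∀ᶠ j in U, ∀ i, (Quotient.mk ((U : Filter J).productSetoid N)
        fun j => (ts i).val (S j) fun x => v x j).out j = (ts i).val (S j) fun x => v x j :=
      (Filter.eventually_cardinal_forall (hτ.2 R)).2 fun i => eventually_out_eq _
    refine Filter.eventually_congr ?_
    filter_upwards [h] with j hj
    simp only [hj]
  | neg φ ih =>
    simp only [InfFormula.Sat, ih]
    exact Ultrafilter.eventually_not.symm
  | conj a φ ih =>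
    simp only [InfFormula.Sat, ih]
    refine (Filter.eventually_cardinal_forall (c := μ) ?_).symm
    rw [mk_Iio_cardIdx]
    exact lt_ord.1 (cardIdx_coe_lt_ord a)
  -- Quantifiers need no completeness, however many variables they bind: a whole counterexample
  -- assignment is chosen in each factor at once.
  | all B φ ih =>
    simp only [InfFormula.Sat]
    constructor
    · intro h
      by_contra hnot
      have hbad := Ultrafilter.eventually_not.2 hnot
      have hex : ∀ j, ∃ w : CardIdx μ → N j, (∀ x, x ∉ B → w x = v x j) ∧
          (¬ (∀ w : CardIdx μ → N j, (∀ x, x ∉ B → w x = v x j) → φ.Sat (S j) w) →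
            ¬ φ.Sat (S j) w) := by
        intro j
        by_cases hj : ∀ w : CardIdx μ → N j, (∀ x, x ∉ B → w x = v x j) → φ.Sat (S j) w
        · exact ⟨fun x => v x j, fun _ _ => rfl, fun h => (h hj).elim⟩
        · push Not at hj
          obtain ⟨w, hw, hw'⟩ := hj
          exact ⟨w, hw, fun _ => hw'⟩
      choose w hw hw' using hex
      have := (ih fun x j => w j x).1 (h _ fun x hx =>
        congrArg (Quotient.mk _) (funext fun j => hw j x hx))
      obtain ⟨j, hj, hj'⟩ := (this.and hbad).exists
      exact hw' j hj' hj
    · intro h w hw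
      let w' : CardIdx μ → ∀ j, N j := fun x => if x ∈ B then (w x).out else v x
      have hww : w = fun x => Quotient.mk ((U : Filter J).productSetoid N) (w' x) := by
        funext x
        by_cases hx : x ∈ B
        · simp only [w', if_pos hx]
          exact (Quotient.out_eq (w x)).symm
        · simp only [w', if_neg hx, hw x hx]
          rfl
      rw [hww, ih]
      filter_upwards [h] with j hj
      exact hj _ fun x hx => by simp only [w', if_neg hx]

lemma isCompactForTypeOmission_of_ultrafilter {κ lam : Cardinal.{u}}
    {I : Set (Set (CardIdx lam))} (hν : ν ≤ μ) {U : Ultrafilter (Set (CardIdx lam))}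
    (hf : IsFine U) (hn : IsNormalUltrafilter U) (hc : IsCompleteUltrafilter μ U)
    (hclub : ∀ C, ContainsStrongClub κ I C → C ∈ U) : IsCompactForTypeOmission μ ν κ I := by
  classical
  intro τ hτ T Ts A x p hT hp hfil hidx hC
  have hμ : CardinalInterFilter (U : Filter (Set (CardIdx lam))) μ := hc
  have hν' : CardinalInterFilter (U : Filter (Set (CardIdx lam))) ν :=
    CardinalInterFilter.of_cardinalInterFilter_of_le _ hν
  have hCU := hclub _ hC
  have hex : ∀ s : Set (CardIdx lam), ∃ (M : Type u) (_ : Nonempty M) (S : VocabStr τ M),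
      HasModelOmitting (Ts s) (fun a => p a '' s) →
        (∀ ψ ∈ Ts s, ∀ v, ψ.Sat S v) ∧ ∀ a, ¬ ∃ m : M, ∀ φ ∈ p a '' s, φ.Sat S fun _ => m := by
    intro s
    by_cases h : HasModelOmitting (Ts s) fun a => p a '' s
    · obtain ⟨M, hM, S, hS⟩ := h
      exact ⟨M, hM, S, fun _ => hS⟩
    · exact ⟨PUnit, inferInstance, ⟨fun _ _ => ⟨⟩, fun _ _ => True⟩, fun h' => (h h').elim⟩
  choose N hN S hS using hex
  refine ⟨(U : Filter (Set (CardIdx lam))).Product N, ⟨Quotient.mk _ fun s => (hN s).some⟩,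
    VocabStr.ultraproduct U S, fun ψ hψ v => ?_, fun a => ?_⟩
  · obtain ⟨Y, hY⟩ := hidx
    rw [hfil.2] at hψ
    simp only [Set.mem_iUnion] at hψ
    obtain ⟨s, hs, hψs⟩ := hψ
    rw [hY s hs] at hψs
    simp only [Set.mem_iUnion] at hψs
    obtain ⟨α, -, hψα⟩ := hψs
    have hv : v = fun x => Quotient.mk ((U : Filter _).productSetoid N) (v x).out := by
      funext x
      exact (Quotient.out_eq _).symm
    rw [hv, InfFormula.sat_ultraproduct S hτ]
    filter_upwards [hCU, hf α] with t ht hαt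
    refine (hS t ht.2).1 ψ ?_ _
    rw [hY t ht.1]
    exact Set.mem_biUnion hαt hψα
  · rintro ⟨m, hm⟩
    have hm' : ∀ α, ∀ᶠ s in U, (p a α).Sat (S s) fun _ => m.out s := by
      intro α
      have := hm _ ⟨α, rfl⟩
      rw [← Quotient.out_eq m] at this
      exact (InfFormula.sat_ultraproduct S hτ (p a α) fun _ => m.out).1 this
    have hbad : ∀ s : Set (CardIdx lam), HasModelOmitting (Ts s) (fun a => p a '' s) →
        ∃ α ∈ s, ¬ (p a α).Sat (S s) fun _ => m.out s := by
      intro s hs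
      by_contra hall
      push Not at hall
      refine (hS s hs).2 a ⟨m.out s, ?_⟩
      rintro _ ⟨α, hα, rfl⟩
      exact hall α hα
    obtain ⟨s₀, hs₀⟩ := U.neBot.nonempty_of_mem hCU
    let F : Set (CardIdx lam) → CardIdx lam := fun s =>
      if h : HasModelOmitting (Ts s) (fun a => p a '' s) then (hbad s h).choose
      else (hbad s₀ hs₀.2).choose
    obtain ⟨α, hα⟩ := hn F (by
      filter_upwards [hCU] with s hs
      simp only [F, dif_pos hs.2]
      exact (hbad s hs.2).choose_spec.1)
    obtain ⟨s, ⟨hsα, hs⟩, hsat⟩ :=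
      U.neBot.nonempty_of_mem (Filter.inter_mem (Filter.inter_mem hα hCU) (hm' α))
    have hspec := (hbad s hs.2).choose_spec.2
    rw [Set.mem_ofPred_eq] at hsα
    simp only [F, dif_pos hs.2] at hsα
    rw [hsα] at hspec
    exact hspec hsat

end Ultraproducts

/-! ### Infinitary propositional logic. -/

section PropositionalVocabulary

variable {μ : Cardinal.{u}} {E : Type u}

/-- The vocabulary with a propositional constant for each element of `E`. -/
def propVocab (E : Type u) : Vocab.{u} where
  Fn := PEmpty
  fnArity := PEmpty.elim
  Rl := E
  rlArity _ := PEmpty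

lemma propVocab_arityLT (E : Type u) : (propVocab E).ArityLT ℵ₀ :=
  ⟨fun f => f.elim, fun _ => by simp [propVocab, aleph0_pos]⟩

/-- The one-point structure given by a truth assignment. -/
def propStr (t : E → Prop) : VocabStr (propVocab E) PUnit.{u + 1} where
  fn f := f.elim
  rl X _ := t X

/-- The truth assignment of a structure. -/
def VocabStr.truth {M : Type u} (S : VocabStr (propVocab E) M) (X : E) : Prop :=
  S.rl X PEmpty.elim

/-- The propositional constant given by `X`, as a formula. -/
def propAtom (μ : Cardinal.{u}) (X : E) : InfFormula (propVocab E) μ :=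
  .rel (τ := propVocab E) X PEmpty.elim

/-- The sentences of `L_{μ,ω}`. -/
def InfFormula.IsSentence {τ : Vocab.{u}} (φ : InfFormula τ μ) : Prop :=
  φ.IsIn ℵ₀ ∧ φ.free = ∅

lemma propAtom_isSentence (X : E) : (propAtom μ X).IsSentence :=
  ⟨trivial, Set.eq_empty_iff_forall_notMem.2 fun x hx => by
    obtain ⟨i, -⟩ := Set.mem_iUnion.1 hx
    exact i.elim⟩

lemma sat_propAtom {M : Type u} (S : VocabStr (propVocab E) M) (X : E) (v : CardIdx μ → M) :
    (propAtom μ X).Sat S v ↔ S.truth X := by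
  have : (fun i : PEmpty => (PEmpty.elim i : InfTerm (propVocab E) (CardIdx μ)).val S v) =
      PEmpty.elim := funext fun i => i.elim
  exact iff_of_eq (congrArg (S.rl X) this)

lemma InfFormula.IsSentence.neg {τ : Vocab.{u}} {φ : InfFormula τ μ} (h : φ.IsSentence) :
    φ.neg.IsSentence := h

lemma exists_sentence_conj {τ : Vocab.{u}} {ι : Type u} (hι : #ι < μ)
    (φ : ι → InfFormula τ μ) (hφ : ∀ i, (φ i).IsSentence) :
    ∃ ψ : InfFormula τ μ, ψ.IsSentence ∧ ∀ (M : Type u) (S : VocabStr τ M) (v : CardIdx μ → M),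
      ψ.Sat S v ↔ ∀ i, (φ i).Sat S v := by
  obtain ⟨a, ha⟩ := exists_cardIdx_coe_eq (ord_lt_ord.2 hι)
  obtain ⟨e⟩ := Cardinal.eq.1
    (show #(Set.Iio a) = #ι by rw [mk_Iio_cardIdx, ha, card_ord])
  have hfree : (⋃ i, (φ (e i)).free) = ∅ := by
    simp only [(hφ _).2, Set.iUnion_empty]
  refine ⟨.conj a fun i => φ (e i), ⟨⟨fun i => (hφ _).1, ?_⟩, hfree⟩, fun M S v => ?_⟩
  · rw [hfree]; simp [aleph0_pos]
  · exact e.forall_congr_right (q := fun i => (φ i).Sat S v)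

end PropositionalVocabulary

/-! ### An ultrafilter from compactness. -/

section UltrafilterOfCompactness

variable {κ μ lam : Cardinal.{u}} {I : Set (Set (CardIdx lam))}

lemma exists_ultrafilter_of_isCompactForTypeOmission (hlam : ℵ₀ ≤ lam) (hμ : ℵ₀ ≤ μ)
    (hI : ∀ α : CardIdx lam, ∃ s ∈ I, α ∈ s) (h : IsCompactForTypeOmission μ ℵ₀ κ I)
    {C : Set (Set (CardIdx lam))} (hC : ContainsStrongClub κ I C) (hinf : ∀ s ∈ C, s.Nonempty) :
    ∃ U : Ultrafilter (Set (CardIdx lam)),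
      C ∈ U ∧ IsFine U ∧ IsNormalUltrafilter U ∧ IsCompleteUltrafilter μ U := by
  classical
  let E := Set (Set (CardIdx lam))
  have : Nonempty (CardIdx lam) := by
    rw [← mk_ne_zero_iff, mk_ord_toType]
    exact (aleph0_pos.trans_le hlam).ne'
  have : Nonempty (CardIdx μ) := by
    rw [← mk_ne_zero_iff, mk_ord_toType]
    exact (aleph0_pos.trans_le hμ).ne'
  let N : Set (CardIdx lam) → VocabStr (propVocab E) PUnit.{u + 1} := fun s => propStr (s ∈ ·)
  have hN : ∀ s X (v : CardIdx μ → PUnit.{u + 1}), (propAtom μ X).Sat (N s) v ↔ s ∈ X :=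
    fun s X v => sat_propAtom _ _ _
  let K : Set (InfFormula (propVocab E) μ) :=
    {ψ | ψ.IsSentence ∧ ∀ s ∈ C, ∀ v, ψ.Sat (N s) v}
  -- `K` is put into every `Y α`, so the filtration respects the index and `T` still contains all of
  -- `K`.
  let Y : CardIdx lam → Set (InfFormula (propVocab E) μ) := fun α =>
    K ∪ {propAtom μ {s | α ∈ s}}
  let Ts : Set (CardIdx lam) → Set (InfFormula (propVocab E) μ) := fun s => ⋃ α ∈ s, Y α
  have hbool : #(ULift.{u} Bool) < μ := (lt_aleph0_of_finite _).trans_le hμ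
  have hpex : ∀ (F : Set (CardIdx lam) → CardIdx lam) (α : CardIdx lam),
      ∃ ψ : InfFormula (propVocab E) μ, ψ.IsSentence ∧
        ∀ (M : Type u) (S : VocabStr (propVocab E) M) (v : CardIdx μ → M),
          ψ.Sat S v ↔ S.truth {s | F s ∈ s} ∧ ¬ S.truth {s | F s = α} := by
    intro F α
    obtain ⟨ψ, hψ, hS⟩ := exists_sentence_conj hbool
      (fun b => if b.down then propAtom μ {s : Set (CardIdx lam) | F s ∈ s}
        else (propAtom μ {s : Set (CardIdx lam) | F s = α}).neg)
      (by
        rintro ⟨_ | _⟩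
        · exact (propAtom_isSentence _).neg
        · exact propAtom_isSentence _)
    refine ⟨ψ, hψ, fun M S v => ?_⟩
    rw [hS, ULift.forall, Bool.forall_bool]
    simp only [if_true, Bool.false_eq_true, if_false, InfFormula.Sat, sat_propAtom]
    exact and_comm
  choose p hp hpS using hpex
  obtain ⟨M, ⟨m⟩, S, hST, hSp⟩ := h (propVocab E) (propVocab_arityLT E) (⋃ s ∈ I, Ts s) Ts
    (Set (CardIdx lam) → CardIdx lam) (Classical.arbitrary _) p
    (by
      intro ψ hψ
      simp only [Set.mem_iUnion, Ts, Y] at hψ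
      obtain ⟨s, -, α, -, h | h⟩ := hψ
      · exact h.1
      · rw [Set.mem_singleton_iff.1 h]
        exact propAtom_isSentence _)
    (fun F α => ⟨(hp F α).1, (hp F α).2.subset.trans (Set.empty_subset _)⟩)
    ⟨fun s _ t _ hst => Set.biUnion_subset_biUnion_left hst, rfl⟩
    ⟨Y, fun s _ => rfl⟩
    (by
      obtain ⟨hCI, F, hF, hFC⟩ := hC
      refine ⟨fun s hs => hs.1, F, hF, hFC.trans fun s hs => ⟨hCI hs, PUnit, inferInstance, N s,
        fun ψ hψ v => ?_, ?_⟩⟩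
      · simp only [Set.mem_iUnion, Ts, Y] at hψ
        obtain ⟨α, hα, h | h⟩ := hψ
        · exact h.2 s hs v
        · rw [Set.mem_singleton_iff.1 h, hN]
          exact hα
      -- A nonempty `s` gives one formula of the type, hence `F s ∈ s`. Then the formula with index
      -- `F s` also belongs to the type, and it is false at `s`.
      · rintro F ⟨m, hm⟩
        obtain ⟨α, hα⟩ := hinf s hs
        have h1 := (hpS F α _ (N s) _).1 (hm _ ⟨α, hα, rfl⟩)
        exact ((hpS F (F s) _ (N s) _).1 (hm _ ⟨F s, h1.1, rfl⟩)).2 rfl)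
  have hsY : ∀ α, ∀ ψ ∈ Y α, ψ.Sat S fun _ => m := by
    intro α ψ hψ
    obtain ⟨s, hs, hα⟩ := hI α
    exact hST ψ (Set.mem_biUnion hs (Set.mem_biUnion hα hψ)) _
  -- Fewer than `μ` sentences that never hold together on `C` do not hold together in `S`, since the
  -- negation of their conjunction is in `K`. All the filter axioms follow from this.
  have hlit : ∀ {ι : Type u} (_ : #ι < μ) (φ : ι → InfFormula (propVocab E) μ)
      (_ : ∀ i, (φ i).IsSentence) (_ : ∀ s ∈ C, ∀ v, ¬ ∀ i, (φ i).Sat (N s) v),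
      ¬ ∀ i, (φ i).Sat S fun _ => m := by
    intro ι hι φ hφ hs
    obtain ⟨ψ, hψ, hψS⟩ := exists_sentence_conj hι φ hφ
    have := hsY (Classical.arbitrary _) ψ.neg (Or.inl ⟨hψ.neg, fun s hsC v => by
      rw [InfFormula.Sat, hψS]
      exact hs s hsC v⟩)
    rwa [InfFormula.Sat, hψS] at this
  have himp : ∀ {ι : Type u} (_ : #ι < μ) (X : ι → E) (Z : E),
      (∀ s ∈ C, (∀ i, s ∈ X i) → s ∈ Z) → (∀ i, S.truth (X i)) → S.truth Z := by
    intro ι hι X Z hXZ hX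
    by_contra hZ
    refine hlit (ι := Option ι) ?_ (fun o => o.elim (propAtom μ Z).neg fun i => propAtom μ (X i))
      ?_ ?_ ?_
    · rw [mk_option]
      exact add_lt_of_lt hμ hι (one_lt_aleph0.trans_le hμ)
    · rintro (_ | i)
      · exact (propAtom_isSentence _).neg
      · exact propAtom_isSentence _
    · intro s hs v hall
      have h1 := hall none
      simp only [Option.elim, InfFormula.Sat, hN] at h1
      exact h1 (hXZ s hs fun i => (hN s _ v).1 (hall (some i)))
    · rintro (_ | i)
      · simpa only [Option.elim, InfFormula.Sat, sat_propAtom] using hZ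
      · simpa only [Option.elim, sat_propAtom] using hX i
  have hcompl : ∀ X : E, ¬ S.truth Xᶜ ↔ S.truth X := by
    intro X
    constructor
    · intro h1
      by_contra h2
      refine hlit hbool (fun b => if b.down then (propAtom μ X).neg else (propAtom μ Xᶜ).neg)
        ?_ ?_ ?_
      · rintro ⟨_ | _⟩ <;> exact (propAtom_isSentence _).neg
      · intro s hs v hall
        rw [ULift.forall, Bool.forall_bool] at hall
        simp only [if_true, Bool.false_eq_true, if_false, InfFormula.Sat, hN] at hall
        exact hall.1 hall.2
      · rw [ULift.forall, Bool.forall_bool]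
        simp only [if_true, Bool.false_eq_true, if_false, InfFormula.Sat, sat_propAtom]
        exact ⟨h1, h2⟩
    · intro h1 h2
      refine hlit hbool (fun b => if b.down then propAtom μ X else propAtom μ Xᶜ) ?_ ?_ ?_
      · rintro ⟨_ | _⟩ <;> exact propAtom_isSentence _
      · intro s hs v hall
        rw [ULift.forall, Bool.forall_bool] at hall
        simp only [if_true, Bool.false_eq_true, if_false, hN] at hall
        exact hall.1 hall.2
      · rw [ULift.forall, Bool.forall_bool]
        simp only [if_true, Bool.false_eq_true, if_false, sat_propAtom]
        exact ⟨h2, h1⟩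
  have hempty : #PEmpty.{u + 1} < μ := by simpa using aleph0_pos.trans_le hμ
  have hunit : #PUnit.{u + 1} < μ := by simpa using one_lt_aleph0.trans_le hμ
  let f : Filter (Set (CardIdx lam)) :=
    { sets := {X | S.truth X}
      univ_sets := himp hempty PEmpty.elim _ (fun _ _ _ => trivial) fun i => i.elim
      sets_of_superset := fun {X Z} hX hXZ =>
        himp hunit (fun _ => X) Z (fun s _ hs => hXZ (hs ⟨⟩)) fun _ => hX
      inter_sets := fun {X Z} hX hZ =>
        himp hbool (fun b => if b.down then X else Z) _
          (fun s _ hs => ⟨hs ⟨true⟩, hs ⟨false⟩⟩) (by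
            rintro ⟨_ | _⟩
            · exact hZ
            · exact hX) }
  have hmem : ∀ X : E, X ∈ f ↔ S.truth X := fun _ => Iff.rfl
  refine ⟨Ultrafilter.ofComplNotMemIff f hcompl, ?_, fun α => ?_, fun F hF => ?_, ⟨?_⟩⟩
  · exact himp hempty PEmpty.elim _ (fun s hs _ => hs) fun i => i.elim
  · exact (sat_propAtom S _ _).1 (hsY α _ (Or.inr rfl))
  · have hFS : S.truth {s | F s ∈ s} := hF
    by_contra hnot
    refine hSp F ⟨m, ?_⟩
    rintro _ ⟨α, rfl⟩
    exact (hpS F α M S _).2 ⟨hFS, fun hα => hnot ⟨α, hα⟩⟩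
  · intro X hX hXU
    exact himp hX (fun Z : X => Z.1) _ (fun s _ hs Z hZ => hs ⟨Z, hZ⟩) fun Z => hXU Z.1 Z.2

end UltrafilterOfCompactness

/-! ### The Mostowski collapse. -/

section MostowskiCollapse

variable {W : Type (u + 1)} {E : W → W → Prop}

/-- The Mostowski collapse of a set-like well-founded relation. -/
noncomputable def mostowski (hwf : WellFounded E) (hs : ∀ b, Small.{u} {a // E a b}) :
    W → ZFSet.{u} :=
  hwf.fix fun b ih =>
    have := hs b
    ZFSet.range fun a : {a // E a b} => ih a.1 a.2

lemma mem_mostowski (hwf : WellFounded E) (hs : ∀ b, Small.{u} {a // E a b}) {b : W}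
    {x : ZFSet.{u}} : x ∈ mostowski hwf hs b ↔ ∃ a, E a b ∧ mostowski hwf hs a = x := by
  have := hs b
  rw [mostowski, hwf.fix_eq, ZFSet.mem_range]
  exact ⟨fun ⟨a, ha⟩ => ⟨a.1, a.2, ha⟩, fun ⟨a, ha, h⟩ => ⟨⟨a, ha⟩, h⟩⟩

lemma mostowski_injective (hwf : WellFounded E) (hs : ∀ b, Small.{u} {a // E a b})
    (hext : ∀ a b, (∀ c, E c a ↔ E c b) → a = b) : Function.Injective (mostowski hwf hs) := by
  intro a
  induction a using hwf.induction with
  | _ a ih =>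
    intro b hab
    refine hext a b fun c => ⟨fun hc => ?_, fun hc => ?_⟩
    · have h1 := (mem_mostowski hwf hs).2 ⟨c, hc, rfl⟩
      rw [hab, mem_mostowski] at h1
      obtain ⟨c', hc', h⟩ := h1
      rwa [ih c hc h.symm]
    · have h1 := (mem_mostowski hwf hs).2 ⟨c, hc, rfl⟩
      rw [← hab, mem_mostowski] at h1
      obtain ⟨c', hc', h⟩ := h1
      rwa [← ih c' hc' h]

end MostowskiCollapse

/-! ### The ultrapower of the universe and its transitive collapse. -/

section UltrapowerOfUniverse

variable {J : Type u} {U : Ultrafilter J}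

lemma relMap_mem {M : Set ZFSet.{u}} (xs : Fin 2 → M) :
    FirstOrder.Language.Structure.RelMap (L := setLang) MembershipRel.mem xs ↔
      (xs 0 : ZFSet.{u}) ∈ (xs 1 : ZFSet.{u}) := Iff.rfl

/-- The ultrapower of the universe of sets. -/
abbrev univPower (U : Ultrafilter J) : Type (u + 1) :=
  (U : Filter J).Product fun _ => (Set.univ : Set ZFSet.{u})

/-- The element of the ultrapower represented by a function. -/
def univPower.mk (U : Ultrafilter J) (f : J → ZFSet.{u}) : univPower U :=
  Quotient.mk _ fun j => ⟨f j, trivial⟩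

lemma univPower.exists_mk (w : univPower U) : ∃ f, univPower.mk U f = w :=
  ⟨fun j => (w.out j).1, Quotient.out_eq w⟩

lemma univPower.mk_eq_mk {f g : J → ZFSet.{u}} :
    univPower.mk U f = univPower.mk U g ↔ ∀ᶠ j in U, f j = g j := by
  refine Quotient.eq.trans (Filter.eventually_congr (Filter.Eventually.of_forall fun j => ?_))
  exact Subtype.ext_iff

/-- The membership relation of the ultrapower. -/
def univPower.Mem (a b : univPower U) : Prop :=
  FirstOrder.Language.Structure.RelMap (L := setLang) MembershipRel.mem ![a, b]

lemma univPower.mem_mk {f g : J → ZFSet.{u}} :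
    univPower.Mem (univPower.mk U f) (univPower.mk U g) ↔ ∀ᶠ j in U, f j ∈ g j := by
  have h := FirstOrder.Language.relMap_quotient_mk' (L := setLang)
    (s := (U : Filter J).productSetoid fun _ => (Set.univ : Set ZFSet.{u}))
    (r := MembershipRel.mem)
    (x := ![fun j => ⟨f j, trivial⟩, fun j => ⟨g j, trivial⟩])
  have h2 : ![univPower.mk U f, univPower.mk U g] = fun i => Quotient.mk
      ((U : Filter J).productSetoid fun _ => (Set.univ : Set ZFSet.{u}))
      ((![fun j => ⟨f j, trivial⟩, fun j => ⟨g j, trivial⟩] :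
        Fin 2 → J → (Set.univ : Set ZFSet.{u})) i) := by
    funext i
    fin_cases i <;> rfl
  rw [univPower.Mem, h2]
  exact h

lemma univPower.mem_wf (hU : CountableInterFilter (U : Filter J)) :
    WellFounded (univPower.Mem (U := U)) := by
  rw [wellFounded_iff_isEmpty_descending_chain]
  refine ⟨fun ⟨w, hw⟩ => ?_⟩
  choose f hf using fun n => univPower.exists_mk (w n)
  have h : ∀ᶠ j in U, ∀ n, f (n + 1) j ∈ f n j := by
    rw [eventually_countable_forall]
    intro n
    rw [← univPower.mem_mk, hf, hf]
    exact hw n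
  obtain ⟨j, hj⟩ := h.exists
  exact (wellFounded_iff_isEmpty_descending_chain.1 ZFSet.mem_wf).false ⟨fun n => f n j, hj⟩

/-- Up to equality almost everywhere, a member of `[g]` is a function into the set `⋃ range g`, and
such functions form a set. -/
lemma univPower.small_mem (b : univPower U) : Small.{u} {a // univPower.Mem a b} := by
  classical
  obtain ⟨g, rfl⟩ := univPower.exists_mk b
  let B : ZFSet.{u} := ZFSet.sUnion (ZFSet.range g)
  have hB : Small.{u} {x // x ∈ B} := ZFSet.small_coe B
  have : Small.{u} (J → {x // x ∈ B}) := small_Pi _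
  have hsub : {a | univPower.Mem a (univPower.mk U g)} ⊆
      Set.range fun h : J → {x // x ∈ B} => univPower.mk U fun j => (h j).1 := by
    intro a ha
    obtain ⟨f, rfl⟩ := univPower.exists_mk a
    have hfg : ∀ᶠ j in U, f j ∈ g j := univPower.mem_mk.1 ha
    have hfB : ∀ᶠ j in U, f j ∈ B := by
      filter_upwards [hfg] with j hj
      exact ZFSet.mem_sUnion.2 ⟨g j, ZFSet.mem_range_self j, hj⟩
    obtain ⟨j₀, hj₀⟩ := hfB.exists
    refine ⟨fun j => if h : f j ∈ B then ⟨f j, h⟩ else ⟨f j₀, hj₀⟩, univPower.mk_eq_mk.2 ?_⟩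
    filter_upwards [hfB] with j hj
    simp only [dif_pos hj]
  exact small_subset hsub

lemma univPower.mem_ext (a b : univPower U)
    (h : ∀ c, univPower.Mem c a ↔ univPower.Mem c b) : a = b := by
  obtain ⟨f, rfl⟩ := univPower.exists_mk a
  obtain ⟨g, rfl⟩ := univPower.exists_mk b
  rw [univPower.mk_eq_mk]
  have key : ∀ f g : J → ZFSet.{u},
      (∀ c, univPower.Mem c (univPower.mk U f) → univPower.Mem c (univPower.mk U g)) →
        ∀ᶠ j in U, f j ⊆ g j := by
    intro f g h
    have hex : ∀ j, ∃ x, ¬ f j ⊆ g j → x ∈ f j ∧ x ∉ g j := by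
      intro j
      by_cases hj : f j ⊆ g j
      · exact ⟨∅, fun h => (h hj).elim⟩
      · by_contra! hall
        exact hj fun x hx => by_contra fun hxg => hxg ((hall x).2 hx)
    choose x hx using hex
    by_contra hnot
    have hbad := Ultrafilter.eventually_not.2 hnot
    have hg := univPower.mem_mk.1 (h (univPower.mk U x) (univPower.mem_mk.2 (by
      filter_upwards [hbad] with j hj using (hx j hj).1)))
    obtain ⟨j, hj, hj'⟩ := (hg.and hbad).exists
    exact (hx j hj').2 hj
  filter_upwards [key f g fun c => (h c).1, key g f fun c => (h c).2] with j h1 h2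
  exact ZFSet.ext fun x => ⟨fun hx => h1 hx, fun hx => h2 hx⟩

lemma exists_collapse_ultrapower (hU : CountableInterFilter (U : Filter J)) :
    ∃ π : (J → ZFSet.{u}) → ZFSet.{u},
      (∀ g x, x ∈ π g ↔ ∃ f, (∀ᶠ j in U, f j ∈ g j) ∧ π f = x) ∧
      (∀ f g, π f = π g ↔ ∀ᶠ j in U, f j = g j) ∧
      ∃ j : (Set.univ : Set ZFSet.{u}) ↪ₑ[setLang] (Set.range π),
        ∀ x, embVal j x = π fun _ => x := by
  let c := mostowski (univPower.mem_wf hU) univPower.small_mem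
  have hc : Function.Injective c := mostowski_injective _ _ univPower.mem_ext
  have hmem : ∀ a b, c a ∈ c b ↔ univPower.Mem a b := by
    intro a b
    refine (mem_mostowski _ _).trans ⟨?_, fun h => ⟨a, h, rfl⟩⟩
    rintro ⟨a', h, he⟩
    rwa [← hc he]
  let π : (J → ZFSet.{u}) → ZFSet.{u} := fun f => c (univPower.mk U f)
  have hrange : ∀ w, c w ∈ Set.range π := by
    intro w
    obtain ⟨f, rfl⟩ := univPower.exists_mk w
    exact ⟨f, rfl⟩
  let e₀ : univPower U ≃ Set.range π := Equiv.ofBijective (fun w => ⟨c w, hrange w⟩)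
    ⟨fun a b h => hc (congrArg Subtype.val h), by
      rintro ⟨_, f, rfl⟩
      exact ⟨univPower.mk U f, rfl⟩⟩
  let e : univPower U ≃[setLang] Set.range π :=
    { e₀ with
      map_fun' := fun f => f.elim
      map_rel' := by
        rintro _ ⟨⟩ xs
        rw [relMap_mem]
        have hxs : ![xs 0, xs 1] = xs := by
          funext i
          fin_cases i <;> rfl
        refine (hmem (xs 0) (xs 1)).trans ?_
        rw [univPower.Mem, hxs] }
  refine ⟨π, fun g x => ?_, fun f g => ?_, ⟨fun x => e (univPower.mk U fun _ => x.1), ?_⟩,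
    fun x => rfl⟩
  · refine (mem_mostowski _ _).trans ⟨?_, ?_⟩
    · rintro ⟨a, ha, rfl⟩
      obtain ⟨f, rfl⟩ := univPower.exists_mk a
      exact ⟨f, univPower.mem_mk.1 ha, rfl⟩
    · rintro ⟨f, hf, rfl⟩
      exact ⟨_, univPower.mem_mk.2 hf, rfl⟩
  · exact hc.eq_iff.trans univPower.mk_eq_mk
  · intro n φ x
    have h1 := FirstOrder.Language.StrongHomClass.realize_formula e φ
      (v := fun i => univPower.mk U fun _ => (x i).1)
    refine Iff.trans h1 ((FirstOrder.Language.Ultraproduct.realize_formula_cast φ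
      fun i _ => x i).trans ?_)
    exact Filter.eventually_const

end UltrapowerOfUniverse

/-! ### The embedding given by an ultrafilter. -/

section EmbeddingOfUltrafilter

variable {κ lam : Cardinal.{u}}

lemma mem_subsetCode {s : Set (CardIdx lam)} {x : ZFSet.{u}} :
    x ∈ subsetCode s ↔ ∃ α ∈ s, (α : Ordinal.{u}).toZFSet = x := by
  simp [subsetCode]

lemma toZFSet_mem_subsetCode {s : Set (CardIdx lam)} {α : CardIdx lam} :
    (α : Ordinal.{u}).toZFSet ∈ subsetCode s ↔ α ∈ s := by
  rw [mem_subsetCode]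
  refine ⟨?_, fun h => ⟨α, h, rfl⟩⟩
  rintro ⟨β, hβ, h⟩
  rwa [← cardIdx_coe_inj.1 (Ordinal.toZFSet_injective h)]

lemma subsetCode_injective : Function.Injective (subsetCode (lam := lam)) := fun s t h =>
  Set.ext fun α => by rw [← toZFSet_mem_subsetCode, h, toZFSet_mem_subsetCode]

lemma mem_familyCode {X : Set (Set (CardIdx lam))} {x : ZFSet.{u}} :
    x ∈ familyCode X ↔ ∃ s ∈ X, subsetCode s = x := by
  simp [familyCode]

lemma subsetCode_mem_familyCode {X : Set (Set (CardIdx lam))} {s : Set (CardIdx lam)} :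
    subsetCode s ∈ familyCode X ↔ s ∈ X := by
  rw [mem_familyCode]
  refine ⟨?_, fun h => ⟨s, h, rfl⟩⟩
  rintro ⟨t, ht, h⟩
  rwa [← subsetCode_injective h]

lemma mem_toZFSet_ord {x : ZFSet.{u}} {o : Ordinal.{u}} (ho : o ≤ lam.ord) :
    x ∈ o.toZFSet ↔
      ∃ α : CardIdx lam, (α : Ordinal.{u}) < o ∧ (α : Ordinal.{u}).toZFSet = x := by
  rw [Ordinal.mem_toZFSet_iff]
  constructor
  · rintro ⟨a, ha, rfl⟩
    obtain ⟨α, rfl⟩ := exists_cardIdx_coe_eq (ha.trans_le ho)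
    exact ⟨α, ha, rfl⟩
  · rintro ⟨α, hα, rfl⟩
    exact ⟨_, hα, rfl⟩

variable {U : Ultrafilter (Set (CardIdx lam))} {I : Set (Set (CardIdx lam))}

/-- In a `κ`-complete ultrafilter, a family of fewer than `κ` sets whose union is large has a
large member. -/
lemma exists_eventually_of_isComplete (hc : IsCompleteUltrafilter κ U) {ι : Type u}
    (hι : #ι < κ) {P : Set (CardIdx lam) → ι → Prop} (h : ∀ᶠ s in U, ∃ i, P s i) :
    ∃ i, ∀ᶠ s in U, P s i := by
  have : CardinalInterFilter (U : Filter (Set (CardIdx lam))) κ := hc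
  by_contra! hnot
  have h2 : ∀ᶠ s in U, ∀ i, ¬ P s i :=
    (Filter.eventually_cardinal_forall hι).2 fun i => by simpa using hnot i
  obtain ⟨s, ⟨i, hi⟩, hs⟩ := (h.and h2).exists
  exact hs i hi

lemma exists_embedding_of_ultrafilter (hκ : ℵ₀ ≤ κ) (hlam : κ ≤ lam) (hI : IsRobust κ I)
    (hf : IsFine U) (hn : IsNormalUltrafilter U) (hc : IsCompleteUltrafilter κ U)
    (hIU : I ∈ U) :
    ∃ (M : Set ZFSet.{u}) (j : (Set.univ : Set ZFSet.{u}) ↪ₑ[setLang] M),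
      IsTransClass M ∧ IsCrit j κ ∧ ptImage j lam ∈ M ∧
        ptImage j lam ∈ embVal j (familyCode I) := by
  have hω := aleph0_lt_of_isNormal hκ hlam hI hf hn hIU
  have hU : CountableInterFilter (U : Filter (Set (CardIdx lam))) := by
    have : CardinalInterFilter (U : Filter (Set (CardIdx lam))) κ := hc
    exact CardinalInterFilter.toCountableInterFilter _ hω
  obtain ⟨π, hmem, heq, j, hj⟩ := exists_collapse_ultrapower hU
  -- Normality says exactly that a member of the class of the identity is represented by a constant
  -- `α`, and so is `j α`.
  have hpt : ptImage j lam = π subsetCode := by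
    ext x
    rw [ptImage, ZFSet.mem_range, hmem]
    constructor
    · rintro ⟨α, rfl⟩
      refine ⟨_, ?_, (hj _).symm⟩
      filter_upwards [hf α] with s hs
      exact toZFSet_mem_subsetCode.2 hs
    · rintro ⟨f, hfs, rfl⟩
      have hex : ∀ s : Set (CardIdx lam), ∃ α : CardIdx lam,
          f s ∈ subsetCode s → α ∈ s ∧ (α : Ordinal.{u}).toZFSet = f s := by
        intro s
        by_cases h : f s ∈ subsetCode s
        · obtain ⟨α, hα⟩ := mem_subsetCode.1 h
          exact ⟨α, fun _ => hα⟩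
        · obtain ⟨s₀, hs₀⟩ := hfs.exists
          exact ⟨(mem_subsetCode.1 hs₀).choose, fun h' => (h h').elim⟩
      choose F hF using hex
      obtain ⟨α, hα⟩ := hn F (by filter_upwards [hfs] with s hs using (hF s hs).1)
      refine ⟨α, ?_⟩
      rw [hj, heq]
      filter_upwards [hα, hfs] with s hsα hs
      rw [← (hF s hs).2, show F s = α from hsα]
  have hfix : ∀ o : Ordinal.{u}, o < κ.ord → π (fun _ => o.toZFSet) = o.toZFSet := by
    intro o
    induction o using WellFoundedLT.induction with
    | ind o ih =>
      intro ho
      have hle : o ≤ lam.ord := ho.le.trans (ord_le_ord.2 hlam)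
      ext x
      rw [hmem]
      constructor
      · rintro ⟨f, hfo, rfl⟩
        obtain ⟨⟨α, hα⟩, hfα⟩ := exists_eventually_of_isComplete hc
          (ι := {α : CardIdx lam // (α : Ordinal.{u}) < o})
          (P := fun s α => (α.1 : Ordinal.{u}).toZFSet = f s)
          (by rw [mk_cardIdx_lt hle]; exact lt_ord.1 ho) (by
            filter_upwards [hfo] with s hs
            obtain ⟨α, hα, h⟩ := (mem_toZFSet_ord hle).1 hs
            exact ⟨⟨α, hα⟩, h⟩)
        rw [← (heq _ f).2 hfα, ih _ hα (hα.trans ho)]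
        exact Ordinal.toZFSet_mem_toZFSet_iff.2 hα
      · intro hx
        obtain ⟨a, ha, rfl⟩ := Ordinal.mem_toZFSet_iff.1 hx
        exact ⟨fun _ => a.toZFSet, Filter.Eventually.of_forall fun _ => hx,
          ih a ha (ha.trans ho)⟩
  refine ⟨Set.range π, j, ?_, ⟨?_, ?_⟩, ?_, ?_⟩
  · rintro _ ⟨g, rfl⟩ y hy
    obtain ⟨f, -, rfl⟩ := (hmem _ _).1 hy
    exact ⟨f, rfl⟩
  · intro h
    rw [hj] at h
    -- By robustness each `s ∈ I` misses some `G s < κ`. The class of `G` lies below `j κ`; if `j κ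
    -- = κ`, it would be some fixed `a < κ`, although almost every `s` contains `a`.
    have hex : ∀ s : Set (CardIdx lam), ∃ o : Ordinal.{u}, s ∈ I →
        ∃ α : CardIdx lam, (α : Ordinal.{u}) = o ∧ o < κ.ord ∧ α ∉ s := by
      intro s
      by_cases hs : s ∈ I
      · by_contra! hall
        refine (hI.2 s hs).not_ge ((mk_below hlam).symm.le.trans ?_)
        refine mk_subtype_le_of_subset fun α hα => ⟨?_, hα⟩
        exact (hall (α : Ordinal.{u})).2 α rfl hα
      · exact ⟨0, fun h => (hs h).elim⟩
    choose G hG using hex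
    have hG' : π (fun s => (G s).toZFSet) ∈ κ.ord.toZFSet := by
      rw [← h, hmem]
      refine ⟨_, ?_, rfl⟩
      filter_upwards [hIU] with s hs
      obtain ⟨α, -, h, -⟩ := hG s hs
      exact Ordinal.toZFSet_mem_toZFSet_iff.2 h
    obtain ⟨a, ha, haG⟩ := Ordinal.mem_toZFSet_iff.1 hG'
    rw [← hfix a ha, heq] at haG
    obtain ⟨β, hβ⟩ := exists_cardIdx_coe_eq (ha.trans_le (ord_le_ord.2 hlam))
    obtain ⟨s, ⟨hsG, hsI⟩, hsβ⟩ := ((haG.and hIU).and (hf β)).exists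
    obtain ⟨α, hα, -, hαs⟩ := hG s hsI
    rw [← Ordinal.toZFSet_injective hsG, ← hβ, cardIdx_coe_inj] at hα
    exact hαs (hα ▸ hsβ)
  · intro o ho
    by_contra! hlt
    exact ho ((hj _).trans (hfix o hlt))
  · rw [hpt]
    exact ⟨_, rfl⟩
  · rw [hpt, hj, hmem]
    refine ⟨_, ?_, rfl⟩
    filter_upwards [hIU] with s hs
    exact subsetCode_mem_familyCode.2 hs

end EmbeddingOfUltrafilter

/-! ### First-order formulas transferred along `j`. -/

section SetFormulas

open FirstOrder.Language

/-- The atomic formula `t₁ ∈ t₂`. -/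
def memFormula {A : Type} {n : ℕ} (t₁ t₂ : setLang.Term (A ⊕ Fin n)) :
    setLang.BoundedFormula A n :=
  Relations.boundedFormula₂ (L := setLang) MembershipRel.mem t₁ t₂

lemma realize_memFormula {A : Type} {n : ℕ} {M : Set ZFSet.{u}} {t₁ t₂ : setLang.Term (A ⊕ Fin n)}
    {v : A → M} {xs : Fin n → M} :
    (memFormula t₁ t₂).Realize v xs ↔
      ((t₁.realize (Sum.elim v xs) : M) : ZFSet.{u}) ∈
        ((t₂.realize (Sum.elim v xs) : M) : ZFSet.{u}) := by
  exact BoundedFormula.realize_rel₂.trans (relMap_mem _)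

/-- The free variable `i`. -/
abbrev freeVar {k n : ℕ} (i : Fin k) : setLang.Term (Fin k ⊕ Fin n) := Term.var (Sum.inl i)

/-- The bound variable `i`. -/
abbrev boundVar {k n : ℕ} (i : Fin n) : setLang.Term (Fin k ⊕ Fin n) := Term.var (Sum.inr i)

variable {M : Set ZFSet.{u}} (j : (Set.univ : Set ZFSet.{u}) ↪ₑ[setLang] M)

lemma embVal_mem_class (x : ZFSet.{u}) : embVal j x ∈ M := (j ⟨x, trivial⟩).2

lemma embVal_realize {k : ℕ} (φ : setLang.Formula (Fin k)) (x : Fin k → ZFSet.{u}) :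
    φ.Realize (fun i => (⟨embVal j (x i), embVal_mem_class j _⟩ : M)) ↔
      φ.Realize (fun i => (⟨x i, trivial⟩ : (Set.univ : Set ZFSet.{u}))) :=
  j.map_formula φ fun i => ⟨x i, trivial⟩

lemma embVal_mem_embVal {x y : ZFSet.{u}} : embVal j x ∈ embVal j y ↔ x ∈ y := by
  have := embVal_realize j (k := 2) (memFormula (freeVar 0) (freeVar 1)) ![x, y]
  simpa [Formula.Realize, realize_memFormula] using this

lemma embVal_inter {x y z : ZFSet.{u}} (h : ∀ s ∈ x, s ∈ y → s ∈ z) :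
    ∀ s ∈ M, s ∈ embVal j x → s ∈ embVal j y → s ∈ embVal j z := by
  have := embVal_realize j (k := 3)
    ((memFormula (boundVar 0) (freeVar 0)).imp ((memFormula (boundVar 0) (freeVar 1)).imp
      (memFormula (n := 1) (boundVar 0) (freeVar 2)))).all ![x, y, z]
  simp [Formula.Realize, realize_memFormula, Fin.snoc] at this
  exact this.2 h

lemma embVal_union {x y z : ZFSet.{u}} (h : ∀ s ∈ x, s ∉ y → s ∈ z) :
    ∀ s ∈ M, s ∈ embVal j x → s ∉ embVal j y → s ∈ embVal j z := by
  have := embVal_realize j (k := 3)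
    ((memFormula (boundVar 0) (freeVar 0)).imp ((memFormula (boundVar 0) (freeVar 1)).not.imp
      (memFormula (n := 1) (boundVar 0) (freeVar 2)))).all ![x, y, z]
  simp [Formula.Realize, realize_memFormula, Fin.snoc] at this
  exact this.2 h

lemma embVal_disjoint {x y : ZFSet.{u}} (h : ∀ s ∈ x, s ∉ y) :
    ∀ s ∈ M, s ∈ embVal j x → s ∉ embVal j y := by
  have := embVal_realize j (k := 2)
    ((memFormula (boundVar 0) (freeVar 0)).imp
      (memFormula (n := 1) (boundVar 0) (freeVar 1)).not).all ![x, y]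
  simp [Formula.Realize, realize_memFormula, Fin.snoc] at this
  exact this.2 h

lemma embVal_fine {x a y : ZFSet.{u}} (h : ∀ s ∈ x, a ∈ s → s ∈ y) :
    ∀ s ∈ M, s ∈ embVal j x → embVal j a ∈ s → s ∈ embVal j y := by
  have := embVal_realize j (k := 3)
    ((memFormula (boundVar 0) (freeVar 0)).imp ((memFormula (freeVar 1) (boundVar 0)).imp
      (memFormula (n := 1) (boundVar 0) (freeVar 2)))).all ![x, a, y]
  simp [Formula.Realize, realize_memFormula, Fin.snoc] at this
  exact this.2 h

lemma embVal_exists_pair {x g : ZFSet.{u}} (h : ∀ s ∈ x, ∃ a ∈ s, ∃ p ∈ g, s ∈ p ∧ a ∈ p) :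
    ∀ s ∈ M, s ∈ embVal j x → ∃ a ∈ s, a ∈ M ∧ ∃ p ∈ embVal j g, s ∈ p ∧ p ∈ M ∧ a ∈ p := by
  have := embVal_realize j (k := 2)
    ((memFormula (boundVar 0) (freeVar 0)).imp
      (((memFormula (boundVar 1) (boundVar 0)) ⊓
        ((memFormula (boundVar 2) (freeVar 1)) ⊓ ((memFormula (boundVar 0) (boundVar 2)) ⊓
          (memFormula (n := 3) (boundVar 1) (boundVar 2)))).ex).ex)).all ![x, g]
  simp [Formula.Realize, realize_memFormula, Fin.snoc] at this
  exact this.2 h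

lemma embVal_pair {x g a y : ZFSet.{u}}
    (h : ∀ s ∈ x, ∀ p ∈ g, a ∈ s → s ∈ p → a ∈ p → s ∈ y) :
    ∀ s ∈ M, s ∈ embVal j x → ∀ p ∈ M, p ∈ embVal j g → embVal j a ∈ s → s ∈ p →
      embVal j a ∈ p → s ∈ embVal j y := by
  have := embVal_realize j (k := 4)
    ((memFormula (boundVar 0) (freeVar 0)).imp
      ((memFormula (boundVar 1) (freeVar 1)).imp ((memFormula (freeVar 2) (boundVar 0)).imp
        ((memFormula (boundVar 0) (boundVar 1)).imp ((memFormula (freeVar 2) (boundVar 1)).imp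
          (memFormula (n := 2) (boundVar 0) (freeVar 3)))))).all).all ![x, g, a, y]
  simp [Formula.Realize, realize_memFormula, Fin.snoc] at this
  exact this.2 h

lemma embVal_initial {x k y : ZFSet.{u}}
    (h : ∀ s ∈ x, (∀ a ∈ s, a ∈ k → ∀ b ∈ a, b ∈ s) → s ∈ y) :
    ∀ s ∈ M, s ∈ embVal j x →
      (∀ a ∈ M, a ∈ s → a ∈ embVal j k → ∀ b ∈ M, b ∈ a → b ∈ s) → s ∈ embVal j y := by
  have := embVal_realize j (k := 3)
    ((memFormula (boundVar 0) (freeVar 0)).imp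
      (((memFormula (boundVar 1) (boundVar 0)).imp ((memFormula (boundVar 1) (freeVar 1)).imp
        ((memFormula (boundVar 2) (boundVar 1)).imp
          (memFormula (n := 3) (boundVar 2) (boundVar 0))).all)).all.imp
            (memFormula (n := 1) (boundVar 0) (freeVar 2)))).all ![x, k, y]
  simp [Formula.Realize, realize_memFormula, Fin.snoc] at this
  exact this.2 h

end SetFormulas

/-! ### The ultrafilter derived from an embedding. -/

section UltrafilterOfEmbedding

variable {κ lam : Cardinal.{u}} {I : Set (Set (CardIdx lam))} {M : Set ZFSet.{u}}

lemma exists_ultrafilter_of_embedding (hlam : κ ≤ lam)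
    (j : (Set.univ : Set ZFSet.{u}) ↪ₑ[setLang] M) (hcrit : IsCrit j κ)
    (hM : ptImage j lam ∈ M) (hI : ptImage j lam ∈ embVal j (familyCode I)) :
    ∃ U : Ultrafilter (Set (CardIdx lam)),
      IsFine U ∧ IsNormalUltrafilter U ∧ IsCompleteUltrafilter κ U ∧ I ∈ U := by
  classical
  set d := ptImage j lam with hd
  have hdmem : ∀ x, x ∈ d ↔ ∃ α : CardIdx lam, embVal j (α : Ordinal.{u}).toZFSet = x := by
    intro x
    simp [hd, ptImage]
  have hfix : ∀ o < κ.ord, embVal j o.toZFSet = o.toZFSet := by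
    intro o ho
    by_contra h
    exact (hcrit.2 h).not_gt ho
  have hinter : ∀ X Y Z : Set (Set (CardIdx lam)), X ∩ Y ⊆ Z → d ∈ embVal j (familyCode X) →
      d ∈ embVal j (familyCode Y) → d ∈ embVal j (familyCode Z) := by
    intro X Y Z h
    refine embVal_inter j (fun s hX hY => ?_) d hM
    obtain ⟨s, hs, rfl⟩ := mem_familyCode.1 hX
    exact subsetCode_mem_familyCode.2 (h ⟨hs, subsetCode_mem_familyCode.1 hY⟩)
  have huniv : d ∈ embVal j (familyCode Set.univ) :=
    hinter I I _ (Set.subset_univ _) hI hI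
  let f : Filter (Set (CardIdx lam)) :=
    { sets := {X | d ∈ embVal j (familyCode X)}
      univ_sets := huniv
      sets_of_superset := fun {X Y} hX hXY => hinter X X Y (by simpa using hXY) hX hX
      inter_sets := fun {X Y} hX hY => hinter X Y _ subset_rfl hX hY }
  have hcompl : ∀ X, Xᶜ ∉ f ↔ X ∈ f := by
    intro X
    constructor
    · intro h
      refine embVal_union j (x := familyCode Set.univ) (y := familyCode Xᶜ) (fun s hs hX => ?_)
        d hM huniv h
      obtain ⟨s, -, rfl⟩ := mem_familyCode.1 hs
      rw [subsetCode_mem_familyCode] at hX ⊢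
      exact not_not.1 hX
    · intro h
      refine embVal_disjoint j (x := familyCode X) (y := familyCode Xᶜ) (fun s hs hX => ?_)
        d hM h
      obtain ⟨s, hsX, rfl⟩ := mem_familyCode.1 hs
      exact subsetCode_mem_familyCode.1 hX hsX
  let U := Ultrafilter.ofComplNotMemIff f hcompl
  have hfine : IsFine U := by
    intro α
    refine embVal_fine j (x := familyCode Set.univ) (a := (α : Ordinal.{u}).toZFSet)
      (fun s hs hα => ?_) d hM huniv ((hdmem _).2 ⟨α, rfl⟩)
    obtain ⟨s, -, rfl⟩ := mem_familyCode.1 hs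
    exact subsetCode_mem_familyCode.2 (toZFSet_mem_subsetCode.1 hα)
  have hnormal : IsNormalUltrafilter U := by
    intro F hF
    -- `F` is coded by unordered pairs `{s, F s}` with `F s ∈ s`. Foundation recovers which member
    -- is the argument, so the transferred formulas need no ordered pairs.
    let g : ZFSet.{u} := ZFSet.range fun s : {s : Set (CardIdx lam) // F s ∈ s} =>
      ({subsetCode s.1, (F s.1 : Ordinal.{u}).toZFSet} : ZFSet.{u})
    obtain ⟨a, had, -, p, hp, hdp, hpM, hap⟩ := embVal_exists_pair j
      (x := familyCode {s | F s ∈ s}) (g := g) (fun s hs => by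
        obtain ⟨s, hsF, rfl⟩ := mem_familyCode.1 hs
        exact ⟨_, toZFSet_mem_subsetCode.2 hsF, _, ZFSet.mem_range_self ⟨s, hsF⟩,
          ZFSet.mem_pair.2 (Or.inl rfl), ZFSet.mem_pair.2 (Or.inr rfl)⟩) d hM hF
    obtain ⟨α, rfl⟩ := (hdmem _).1 had
    refine ⟨α, embVal_pair j (x := familyCode {s | F s ∈ s}) (g := g)
      (a := (α : Ordinal.{u}).toZFSet) (fun s hs p hp has hsp hap => ?_)
      d hM hF p hpM hp had hdp hap⟩
    obtain ⟨s, hs, rfl⟩ := mem_familyCode.1 hs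
    obtain ⟨⟨t, ht⟩, rfl⟩ := ZFSet.mem_range.1 hp
    have ht' := toZFSet_mem_subsetCode.2 ht
    rcases ZFSet.mem_pair.1 hsp with h1 | h1 <;> rcases ZFSet.mem_pair.1 hap with h2 | h2
    · rw [h1, h2] at has
      exact (ZFSet.mem_irrefl _ has).elim
    · refine subsetCode_mem_familyCode.2 ?_
      rw [subsetCode_injective h1]
      exact (cardIdx_coe_inj.1 (Ordinal.toZFSet_injective h2)).symm
    · rw [h1, h2] at has
      exact (ZFSet.mem_asymm has ht').elim
    · rw [h1, h2] at has
      exact (ZFSet.mem_irrefl _ has).elim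
  -- `κ`-completeness reduces to `j"lam ∩ j(κ)` being an initial segment of `j(κ)`. If `j(α) < j(κ)`
  -- then `α < κ`, so `j` fixes `α` and everything below it.
  refine ⟨U, hfine, hnormal, isComplete_of_initialSets_mem hlam hfine hnormal ?_, hI⟩
  refine embVal_initial j (x := familyCode Set.univ) (k := κ.ord.toZFSet) (fun s hs h => ?_)
    d hM huniv ?_
  · obtain ⟨s, -, rfl⟩ := mem_familyCode.1 hs
    refine subsetCode_mem_familyCode.2 fun x hx hxκ y hy => toZFSet_mem_subsetCode.1 ?_
    exact h _ (toZFSet_mem_subsetCode.2 hx) (Ordinal.toZFSet_mem_toZFSet_iff.2 hxκ) _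
      (Ordinal.toZFSet_mem_toZFSet_iff.2 (cardIdx_coe_lt.2 hy))
  · intro a _ had haκ b _ hba
    obtain ⟨α, rfl⟩ := (hdmem _).1 had
    rw [embVal_mem_embVal, Ordinal.toZFSet_mem_toZFSet_iff] at haκ
    rw [hfix _ haκ, mem_toZFSet_ord (cardIdx_coe_lt_ord α).le] at hba
    obtain ⟨β, hβ, rfl⟩ := hba
    exact (hdmem _).2 ⟨β, hfix _ (hβ.trans haκ)⟩

end UltrafilterOfEmbedding

/-! ### Assembling the equivalences. -/

section Equivalence

lemma InfFormula.IsIn.mono {τ : Vocab.{u}} {μ ν ν' : Cardinal.{u}} (h : ν ≤ ν')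
    {φ : InfFormula τ μ} (hφ : φ.IsIn ν) : φ.IsIn ν' := by
  induction φ with
  | eq | rel => trivial
  | neg φ ih => exact ih hφ
  | conj a φ ih => exact ⟨fun i => ih i (hφ.1 i), hφ.2.trans_le h⟩
  | all B φ ih => exact ⟨hφ.1.trans_le h, ih hφ.2⟩

lemma IsCompactForTypeOmission.mono {μ ν ν' κ lam : Cardinal.{u}} {I : Set (Set (CardIdx lam))}
    (hν : ν ≤ ν') (h : IsCompactForTypeOmission μ ν' κ I) :
    IsCompactForTypeOmission μ ν κ I :=
  fun τ hτ T Ts A x p hT hp =>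
    h τ ⟨fun f => (hτ.1 f).trans_le hν, fun R => (hτ.2 R).trans_le hν⟩ T Ts A x p
      (fun ψ hψ => ⟨(hT ψ hψ).1.mono hν, (hT ψ hψ).2⟩)
      fun a α => ⟨(hp a α).1.mono hν, (hp a α).2⟩

/-- Compactness for type omission yields an ultrafilter that is also `κ`-complete. -/
lemma exists_complete_ultrafilter_of_isCompactForTypeOmission {κ μ lam : Cardinal.{u}}
    {I : Set (Set (CardIdx lam))} (hκ : ℵ₀ ≤ κ) (hlam : κ ≤ lam) (hI : IsRobust κ I)
    (hμ : ℵ₀ ≤ μ) (h : IsCompactForTypeOmission μ ℵ₀ κ I) :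
    ∃ U : Ultrafilter (Set (CardIdx lam)), I ∈ U ∧ IsFine U ∧ IsNormalUltrafilter U ∧
      IsCompleteUltrafilter μ U ∧ IsCompleteUltrafilter κ U := by
  -- The club of sets closed under `initialClosure` brings in `κ`-completeness, whatever `μ` is.
  obtain ⟨U, hCU, hf, hn, hc⟩ := exists_ultrafilter_of_isCompactForTypeOmission
    (hκ.trans hlam) hμ hI.1 h (C := closureSet I (initialClosure κ lam))
    ⟨fun s hs => hs.1, _, mk_initialClosure_lt hκ, subset_rfl⟩ fun s hs => hs.2.1.nonempty
  exact ⟨U, Filter.mem_of_superset hCU fun s hs => hs.1, hf, hn, hc,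
    isComplete_of_initialSets_mem hlam hf hn
      (Filter.mem_of_superset hCU (closureSet_initialClosure_subset I))⟩

end Equivalence

theorem mainTheorem1 (κ lam : Cardinal.{u}) (hκ : ℵ₀ ≤ κ) (hlam : κ ≤ lam)
    (I : Set (Set (CardIdx lam))) (hI : IsRobust κ I) :
    List.TFAE [
      IsCompactForTypeOmission κ ℵ₀ κ I,
      IsCompactForTypeOmission κ κ κ I,
      ∃ U : Ultrafilter (Set (CardIdx lam)),
        IsFine U ∧ IsNormalUltrafilter U ∧ IsMaximallyComplete κ U ∧ I ∈ U,
      ∃ (M : Set ZFSet.{u}) (j : (Set.univ : Set ZFSet.{u}) ↪ₑ[setLang] M),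
        IsTransClass M ∧ IsCrit j κ ∧ ptImage j lam ∈ M ∧
          ptImage j lam ∈ embVal j (familyCode I)] ∧
    (∀ μ : Cardinal.{u},
      IsLeast {μ' : Cardinal.{u} | ℵ₀ ≤ μ' ∧ IsCompactForTypeOmission μ' ℵ₀ κ I} μ →
      IsLeast {μ' : Cardinal.{u} | ℵ₀ ≤ μ' ∧ ∃ U : Ultrafilter (Set (CardIdx lam)),
        I ∈ U ∧ IsFine U ∧ IsNormalUltrafilter U ∧ IsCompleteUltrafilter μ' U} μ) ∧
    (∀ μ : Cardinal.{u}, ℵ₀ ≤ μ →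
      (IsCompactForTypeOmission μ ℵ₀ κ I ↔
        ∃ U : Ultrafilter (Set (CardIdx lam)),
          I ∈ U ∧ IsFine U ∧ IsNormalUltrafilter U ∧ IsCompleteUltrafilter μ U ∧
            ∀ C, ContainsStrongClub κ I C → C ∈ U)) := by
  have key : ∀ μ : Cardinal.{u}, ℵ₀ ≤ μ →
      (IsCompactForTypeOmission μ ℵ₀ κ I ↔
        ∃ U : Ultrafilter (Set (CardIdx lam)),
          I ∈ U ∧ IsFine U ∧ IsNormalUltrafilter U ∧ IsCompleteUltrafilter μ U ∧
            ∀ C, ContainsStrongClub κ I C → C ∈ U) := by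
    intro μ hμ
    constructor
    · intro h
      obtain ⟨U, hIU, hf, hn, hc, hc'⟩ :=
        exists_complete_ultrafilter_of_isCompactForTypeOmission hκ hlam hI hμ h
      exact ⟨U, hIU, hf, hn, hc, fun C => containsStrongClub_mem hκ hlam hI hf hn hc' hIU⟩
    · rintro ⟨U, -, hf, hn, hc, hclub⟩
      exact isCompactForTypeOmission_of_ultrafilter hμ hf hn hc hclub
  refine ⟨?_, fun μ hμ => ?_, key⟩
  · tfae_have 1 → 3 := by
      intro h
      obtain ⟨U, hIU, hf, hn, -, hc⟩ :=
        exists_complete_ultrafilter_of_isCompactForTypeOmission hκ hlam hI hκ h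
      exact ⟨U, hf, hn, ⟨hc, not_isComplete_succ hlam hI hf hIU⟩, hIU⟩
    tfae_have 3 → 2 := by
      rintro ⟨U, hf, hn, ⟨hc, -⟩, hIU⟩
      exact isCompactForTypeOmission_of_ultrafilter le_rfl hf hn hc fun C =>
        containsStrongClub_mem hκ hlam hI hf hn hc hIU
    tfae_have 2 → 1 := fun h => h.mono hκ
    tfae_have 3 → 4 := by
      rintro ⟨U, hf, hn, ⟨hc, -⟩, hIU⟩
      exact exists_embedding_of_ultrafilter hκ hlam hI hf hn hc hIU
    tfae_have 4 → 3 := by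
      rintro ⟨M, j, -, hcrit, hM, hIM⟩
      obtain ⟨U, hf, hn, hc, hIU⟩ := exists_ultrafilter_of_embedding hlam j hcrit hM hIM
      exact ⟨U, hf, hn, ⟨hc, not_isComplete_succ hlam hI hf hIU⟩, hIU⟩
    tfae_finish
  · obtain ⟨U, hIU, hf, hn, hc, hclub⟩ := (key μ hμ.1.1).1 hμ.1.2
    -- Every filter is `ℵ₀`-complete, so the same `U` gives compactness for `ℵ₀`. Hence both least
    -- cardinals are `ℵ₀`.
    have h0 : IsCompactForTypeOmission ℵ₀ ℵ₀ κ I := (key ℵ₀ le_rfl).2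
      ⟨U, hIU, hf, hn, Filter.cardinalInterFilter_aleph0 _, hclub⟩
    exact ⟨⟨hμ.1.1, U, hIU, hf, hn, hc⟩, fun μ' hμ' => (hμ.2 ⟨le_rfl, h0⟩).trans hμ'.1⟩
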